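/- Let $x_0,u_0\in\mathbb R$, and consider the scalar Cauchy problem $$u'(x)-N(x,u(x))\,u(x)=\varphi(x),\quad x\in[x_0,+\infty),\qquad u(x_0)=u_0. \tag{1}$$ Assume: (i) $N(x,u)=\sum_{i\ge 0}a_i(x)u^i$ for all $x\ge x_0$, $u\in\mathbb R$, where the $a_i$ are continuous on $[x_0,+\infty)$, $|a_i(x)|\le B_i$ for all $x\ge x_0$, and $\sum_{i\ge0} B_iu^i$ converges for every $u\in\mathbb R$; (ii) $\varphi$ is continuous on $[x_0,+\infty)$ and $|\varphi(x)|\le k<\infty$ there; (iii) for some $\alpha>0$, $\frac{\partial}{\partial u}\bigl(N(x,u)u\bigr)<-\alpha$ for all $x\ge x_0$, $u\in\mathbb R$. For smooth $f$ and numbers $v_0,\dots,v_k$ let $$A_k(f;v_0,\dots,v_k)=\frac1{k!}\frac{d^k}{dt^k}f\Bigl(\sum_{i=0}^k t^iv_i\Bigr)\Big|_{t=0}$$ be the Adomian polynomial. A grid is a sequence $x_0<x_1<x_2<\cdots$ with $x_n\to+\infty$ and its mesh is $h=\sup_{i\ge1}(x_i-x_{i-1})$. For a given grid, the terms $u^{(0)},u^{(1)},\dots$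 of the FD-method are the continuous functions on $[x_0,+\infty)$ with $u^{(0)}(x_0)=u_0$, $u^{(j+1)}(x_0)=0$ and, for all $i\ge 1$, $j\ge0$ and $x\in[x_{i-1},x_i]$, $$\frac{d}{dx}u^{(0)}(x)-N\bigl(x,u^{(0)}(x_{i-1})\bigr)u^{(0)}(x)=\varphi(x),$$ $$\frac{d}{dx}u^{(j+1)}(x)-N\bigl(x,u^{(0)}(x_{i-1})\bigr)u^{(j+1)}(x)=N'_u\bigl(x,u^{(0)}(x_{i-1})\bigr)u^{(0)}(x)\,u^{(j+1)}(x_{i-1})+F^{(j+1)}(x),$$ where $$\begin{aligned}F^{(j+1)}(x)={}&\sum_{p=1}^{j}A_{j+1-p}\bigl(N(x,\cdot);u^{(0)}(x_{i-1}),\dots,u^{(j+1-p)}(x_{i-1})\bigr)u^{(p)}(x)\\&+\sum_{p=0}^{j}\Bigl[A_{j-p}\bigl(N(x,\cdot);u^{(0)}(x),\dots,u^{(j-p)}(x)\bigr)-A_{j-p}\bigl(N(x,\cdot);u^{(0)}(x_{i-1}),\dots,u^{(j-p)}(x_{i-1})\bigr)\Bigr]u^{(p)}(x)\\&+A_{j+1}\bigl(N(x,\cdot);u^{(0)}(x_{i-1}),\dots,u^{(j)}(x_{i-1}),0\bigr)u^{(0)}(x).\end{aligned}$$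 Then these terms exist for every grid, and problem (1) has a unique solution $u$ on $[x_0,+\infty)$. The FD-method converges to it: there is $\overline h>0$ such that for every grid of mesh $h\le\overline h$ the series $\sum_{j\ge0}u^{(j)}(x)$ converges to $u(x)$ uniformly on $[x_0,+\infty)$. Moreover, there are positive constants $C,R,\varepsilon$, depending only on the data of problem (1) and not on the grid, such that for every grid of mesh $h$ and every $m\ge 0$ $$\sup_{x\ge x_0}\Bigl|u(x)-\sum_{j=0}^m u^{(j)}(x)\Bigr|\le\frac{C}{(1+m)^{1+\varepsilon}}\,\frac{(h/R)^{m+1}}{1-h/R}\quad\text{if } h<R,$$ $$\sup_{x\ge x_0}\Bigl|u(x)-\sum_{j=0}^m u^{(j)}(x)\Bigr|\le C\sum_{j=m+1}^{\infty}\frac1{(j+1)^{1+\varepsilon}}\quad\text{if } h=R.$$ -/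

import Mathlib

open Set Filter Topology

namespace FDMethod

/-- An infinite grid `x₀ = node 0 < node 1 < node 2 < …` on `[x₀, +∞)` with `node n → +∞`. -/
structure Grid (x₀ : ℝ) where
  /-- The nodes of the grid. -/
  node : ℕ → ℝ
  node_zero : node 0 = x₀
  node_strictMono : StrictMono node
  node_tendsto : Tendsto node atTop atTop

/-- The grid `G` has the (finite) mesh `h`: the supremum of the step lengths exists in `ℝ` and
equals `h`. -/
def Grid.HasMesh {x₀ : ℝ} (G : Grid x₀) (h : ℝ) : Prop :=
  IsLUB (Set.range fun i : ℕ => G.node (i + 1) - G.node i) h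

/-- `u` is a solution on `[x₀, +∞)` of the Cauchy problem
`u' - N(x, u) u = φ(x)`, `u(x₀) = u₀` (the derivative at `x₀` is the right one). -/
def IsCauchySolution (x₀ u₀ : ℝ) (N : ℝ → ℝ → ℝ) (φ : ℝ → ℝ) (u : ℝ → ℝ) : Prop :=
  u x₀ = u₀ ∧
    ∀ x ∈ Set.Ici x₀, HasDerivWithinAt u (N x (u x) * u x + φ x) (Set.Ici x₀) x

/-- The Adomian polynomial `A_k(f; v 0, …, v k)`, that is
`(1 / k!) (d/dt)^k f(∑ tⁱ v i)` at `t = 0`. Powers of `t` beyond the `k`-th do not contribute to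
this derivative, so the inner series is cut after the `k`-th term. -/
noncomputable def adomian (k : ℕ) (f : ℝ → ℝ) (v : ℕ → ℝ) : ℝ :=
  iteratedDeriv k (fun t : ℝ => f (∑ i ∈ Finset.range (k + 1), t ^ i * v i)) 0 / (k.factorial : ℝ)

/-- The term `F^{(j+1)}(x)` of the right-hand side on a grid interval with left end point `xl`,
formed from the functions `U 0, …, U j`. -/
noncomputable def rhsF (N : ℝ → ℝ → ℝ) (U : ℕ → ℝ → ℝ) (xl : ℝ) (j : ℕ) (x : ℝ) : ℝ :=
  (∑ p ∈ Finset.Icc 1 j, adomian (j + 1 - p) (N x) (fun i => U i xl) * U p x)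
  + (∑ p ∈ Finset.range (j + 1),
      (adomian (j - p) (N x) (fun i => U i x) - adomian (j - p) (N x) (fun i => U i xl)) * U p x)
  + adomian (j + 1) (N x) (fun i => if i ≤ j then U i xl else 0) * U 0 x

/-- The sequence `U 0, U 1, …` consists of the terms of the FD-method on the grid `G`: continuous
functions on `[x₀, +∞)` which on every grid interval solve the linear Cauchy problems with frozen
coefficients (derivatives at the end points of a grid interval are one-sided). -/
structure IsFDTerms {x₀ : ℝ} (u₀ : ℝ) (N : ℝ → ℝ → ℝ) (φ : ℝ → ℝ) (G : Grid x₀)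
    (U : ℕ → ℝ → ℝ) : Prop where
  continuousOn : ∀ j, ContinuousOn (U j) (Set.Ici x₀)
  initial_zero : U 0 x₀ = u₀
  initial_succ : ∀ j, U (j + 1) x₀ = 0
  equation_zero : ∀ i : ℕ, ∀ x ∈ Set.Icc (G.node i) (G.node (i + 1)),
    HasDerivWithinAt (U 0) (N x (U 0 (G.node i)) * U 0 x + φ x)
      (Set.Icc (G.node i) (G.node (i + 1))) x
  equation_succ : ∀ j i : ℕ, ∀ x ∈ Set.Icc (G.node i) (G.node (i + 1)),
    HasDerivWithinAt (U (j + 1))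
      (N x (U 0 (G.node i)) * U (j + 1) x
        + deriv (N x) (U 0 (G.node i)) * U 0 x * U (j + 1) (G.node i)
        + rhsF N U (G.node i) j x)
      (Set.Icc (G.node i) (G.node (i + 1))) x

/-- The partial sum `U 0 + … + U m`. -/
def partialSum (U : ℕ → ℝ → ℝ) (m : ℕ) (x : ℝ) : ℝ :=
  ∑ j ∈ Finset.range (m + 1), U j x

/-- The FD-method converges to `u` on `[x₀, +∞)`: there is `hbar > 0` such that on every grid of
mesh at most `hbar` the series of the terms converges to `u` uniformly on `[x₀, +∞)`. -/
def FDConvergesTo (x₀ u₀ : ℝ) (N : ℝ → ℝ → ℝ) (φ : ℝ → ℝ) (u : ℝ → ℝ) : Prop :=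
  ∃ hbar : ℝ, 0 < hbar ∧ ∀ (G : Grid x₀) (h : ℝ), G.HasMesh h → h ≤ hbar →
    ∀ U : ℕ → ℝ → ℝ, IsFDTerms u₀ N φ G U →
      TendstoUniformlyOn (partialSum U) u atTop (Set.Ici x₀)

end FDMethod

/-! For fixed `x` and a left node `xl`, let `V(t) = ∑ U i x t^i` and `W(t) = ∑ U i xl t^i`. Adomian
polynomials are the Taylor coefficients of `N x` composed with such a series (`adomian_eq_coeff`),
so the whole scheme reads `V' = V N(W) + t V (N(V) - N(W)) + φ` coefficientwise (`termDeriv_succ`).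
At `t = 1` the frozen argument cancels, and the sum solves the Cauchy problem as soon as the series
may be summed.

Convergence rests on the weights `r^j / (j+1)^2`: their convolution costs only a factor 16, so
domination by weights survives products, powers and composition with an entire function. With `r = h
/ R`, strong induction in `abs_terms_le` gives `|U j| ≤ δ * weight r j` for `j ≥ 1`, together with a
bound for the derivatives. In the source term `rhsF` two parts are of second order in the terms of
positive index, hence `O(δ^2)`. The third is a difference across one grid step, so it is
proportional to `R r`, and this `r` pays for the passage from weight `j` to weight `j + 1`
(`abs_rhsF_le`).

The bounds do not deteriorate along the half-line because the linear problems are dissipative: `N ≤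
-α`, and `N + N' u < -α` makes the combined coefficient of the frozen equation negative on short
steps. A barrier argument (`abs_le_of_frozen`) then carries the same bound from node to node.

The uniform grid of step `R` already produces a solution; monotonicity makes it unique, hence every
admissible grid sums to it. The error is a tail of the weights, which yields `ε = 1`. -/

namespace FDMethod

/-! ### Power series with weighted coefficient bounds -/

section PowerSeries

open PowerSeries

/-- The weights `r ^ j / (j + 1) ^ 2`, which are submultiplicative under convolution up to a
constant factor. -/
noncomputable def weight (r : ℝ) (j : ℕ) : ℝ := r ^ j / ((j : ℝ) + 1) ^ 2

/-- The coefficients of `V` are bounded by `c` times the weights. -/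
def Dominated (r c : ℝ) (V : PowerSeries ℝ) : Prop := ∀ j, |coeff j V| ≤ c * weight r j

lemma weight_nonneg {r : ℝ} (hr : 0 ≤ r) (j : ℕ) : 0 ≤ weight r j := by
  unfold weight; positivity

lemma weight_pos {r : ℝ} (hr : 0 < r) (j : ℕ) : 0 < weight r j := by
  unfold weight; positivity

lemma weight_zero (r : ℝ) : weight r 0 = 1 := by simp [weight]

/-- Since `j + 2 ≤ 2 (j + 1)`, a spare factor `r`, coming from a step length, raises the index of a
weight by one. -/
lemma mul_weight_le {r : ℝ} (hr : 0 ≤ r) (j : ℕ) : r * weight r j ≤ 4 * weight r (j + 1) := by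
  unfold weight
  have h : 1 / ((j : ℝ) + 1) ^ 2 ≤ 4 / ((j : ℝ) + 1 + 1) ^ 2 := by
    rw [div_le_div_iff₀ (by positivity) (by positivity)]
    nlinarith [(Nat.cast_nonneg j : (0 : ℝ) ≤ j)]
  have h2 := mul_le_mul_of_nonneg_left h (pow_nonneg hr (j + 1))
  push_cast
  calc r * (r ^ j / ((j : ℝ) + 1) ^ 2) = r ^ (j + 1) * (1 / ((j : ℝ) + 1) ^ 2) := by ring
    _ ≤ _ := h2
    _ = _ := by ring

lemma summable_inv_sq : Summable fun j : ℕ => 1 / ((j : ℝ) + 1) ^ 2 := by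
  have := (summable_nat_add_iff 1).2 (Real.summable_one_div_nat_pow.2 (le_refl 2))
  simpa using this

lemma weight_le_inv_sq {r : ℝ} (hr : 0 ≤ r) (hr1 : r ≤ 1) (j : ℕ) :
    weight r j ≤ 1 / ((j : ℝ) + 1) ^ 2 := by
  unfold weight
  gcongr
  exact pow_le_one₀ hr hr1

lemma summable_weight {r : ℝ} (hr : 0 ≤ r) (hr1 : r ≤ 1) : Summable (weight r) :=
  Summable.of_nonneg_of_le (weight_nonneg hr) (weight_le_inv_sq hr hr1) summable_inv_sq

lemma sum_inv_sq_le (n : ℕ) :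
    ∑ j ∈ Finset.range (n + 1), 1 / ((j : ℝ) + 1) ^ 2 ≤ 2 - 1 / ((n : ℝ) + 1) := by
  induction n with
  | zero => norm_num
  | succ n ih =>
    rw [Finset.sum_range_succ]
    have : 1 / (((n + 1 : ℕ) : ℝ) + 1) ^ 2 ≤ 1 / ((n : ℝ) + 1) - 1 / (((n + 1 : ℕ) : ℝ) + 1) := by
      push_cast
      have h0 : (0 : ℝ) ≤ n := Nat.cast_nonneg n
      rw [div_sub_div _ _ (by positivity) (by positivity),
        div_le_div_iff₀ (by positivity) (by positivity)]
      nlinarith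
    linarith

/-- The larger of `p + 1` and `q + 1` is at least half of `p + q + 1`, so one of the two factors can
be traded for the weight of the total degree. -/
lemma inv_sq_mul_inv_sq_le (p q : ℕ) :
    1 / ((p : ℝ) + 1) ^ 2 * (1 / ((q : ℝ) + 1) ^ 2) ≤
      4 / (((p + q : ℕ) : ℝ) + 1) ^ 2 * (1 / ((p : ℝ) + 1) ^ 2 + 1 / ((q : ℝ) + 1) ^ 2) := by
  push_cast
  have hp : (0 : ℝ) ≤ p := Nat.cast_nonneg p
  have hq : (0 : ℝ) ≤ q := Nat.cast_nonneg q
  rw [div_add_div _ _ (by positivity) (by positivity), div_mul_div_comm, div_mul_div_comm,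
    div_le_div_iff₀ (by positivity) (by positivity)]
  have h : ((p : ℝ) + q + 1) ^ 2 ≤
      4 * (1 * ((q : ℝ) + 1) ^ 2 + ((p : ℝ) + 1) ^ 2 * 1) := by
    nlinarith [sq_nonneg ((p : ℝ) - q)]
  have h2 : 0 ≤ ((p : ℝ) + 1) ^ 2 * ((q : ℝ) + 1) ^ 2 := by positivity
  nlinarith [mul_le_mul_of_nonneg_right h h2]

/-- The square in the denominator makes the remaining sums over `p` and over `q` bounded by 2 each,
whence `16 = 4 * (2 + 2)`. -/
lemma sum_weight_mul_le {r : ℝ} (hr : 0 ≤ r) (n : ℕ) :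
    ∑ p ∈ Finset.HasAntidiagonal.antidiagonal n, weight r p.1 * weight r p.2 ≤ 16 * weight r n := by
  have h1 : ∀ p ∈ Finset.HasAntidiagonal.antidiagonal n, weight r p.1 * weight r p.2 ≤
      4 * weight r n * (1 / ((p.1 : ℝ) + 1) ^ 2 + 1 / ((p.2 : ℝ) + 1) ^ 2) := by
    rintro ⟨p, q⟩ hp
    obtain rfl := Finset.HasAntidiagonal.mem_antidiagonal.1 hp
    have := mul_le_mul_of_nonneg_left (inv_sq_mul_inv_sq_le p q) (pow_nonneg hr (p + q))
    unfold weight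
    calc _ = r ^ (p + q) * (1 / ((p : ℝ) + 1) ^ 2 * (1 / ((q : ℝ) + 1) ^ 2)) := by ring
      _ ≤ _ := this
      _ = _ := by ring
  refine (Finset.sum_le_sum h1).trans ?_
  rw [← Finset.mul_sum, Finset.sum_add_distrib]
  have e1 : ∑ p ∈ Finset.HasAntidiagonal.antidiagonal n, 1 / ((p.1 : ℝ) + 1) ^ 2 ≤ 2 := by
    rw [Finset.Nat.sum_antidiagonal_eq_sum_range_succ_mk]
    exact (sum_inv_sq_le n).trans (by simp; positivity)
  have e2 : ∑ p ∈ Finset.HasAntidiagonal.antidiagonal n, 1 / ((p.2 : ℝ) + 1) ^ 2 ≤ 2 := by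
    rw [← Finset.Nat.sum_antidiagonal_swap]
    exact e1
  nlinarith [weight_nonneg hr n]

namespace Dominated

variable {r c d : ℝ} {V W : PowerSeries ℝ}

lemma mono (hr : 0 ≤ r) (h : Dominated r c V) (hcd : c ≤ d) : Dominated r d V := fun j =>
  (h j).trans (mul_le_mul_of_nonneg_right hcd (weight_nonneg hr j))

lemma add (hV : Dominated r c V) (hW : Dominated r d W) : Dominated r (c + d) (V + W) := fun j => by
  rw [map_add, add_mul]
  exact (abs_add_le _ _).trans (add_le_add (hV j) (hW j))

lemma sub (hV : Dominated r c V) (hW : Dominated r d W) : Dominated r (c + d) (V - W) := fun j => by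
  rw [map_sub, add_mul]
  exact (abs_sub _ _).trans (add_le_add (hV j) (hW j))

lemma mul (hr : 0 ≤ r) (hc : 0 ≤ c) (hV : Dominated r c V) (hW : Dominated r d W) :
    Dominated r (16 * c * d) (V * W) := fun j => by
  have hd : 0 ≤ d := by
    have := (abs_nonneg _).trans (hW 0)
    rwa [weight_zero, mul_one] at this
  rw [coeff_mul]
  calc _ ≤ ∑ p ∈ Finset.HasAntidiagonal.antidiagonal j, |coeff p.1 V * coeff p.2 W| := Finset.abs_sum_le_sum_abs _ _
    _ ≤ ∑ p ∈ Finset.HasAntidiagonal.antidiagonal j, c * d * (weight r p.1 * weight r p.2) := by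
        refine Finset.sum_le_sum fun p _ => ?_
        rw [abs_mul]
        calc _ ≤ (c * weight r p.1) * (d * weight r p.2) :=
              mul_le_mul (hV _) (hW _) (abs_nonneg _) (mul_nonneg hc (weight_nonneg hr _))
          _ = _ := by ring
    _ ≤ c * d * (16 * weight r j) := by
        rw [← Finset.mul_sum]
        exact mul_le_mul_of_nonneg_left (sum_weight_mul_le hr j) (mul_nonneg hc hd)
    _ = _ := by ring

lemma C_mul (h : Dominated r c V) (s : ℝ) (hs : |s| ≤ d) :
    Dominated r (d * c) (C s * V) := fun j => by
  rw [coeff_C_mul, abs_mul, mul_assoc]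
  exact mul_le_mul hs (h j) (abs_nonneg _) ((abs_nonneg _).trans hs)

lemma one (hr : 0 ≤ r) : Dominated r 1 1 := fun j => by
  rw [coeff_one]
  split_ifs with h
  · simp [h, weight_zero]
  · simpa using weight_nonneg hr j

lemma const (hr : 0 ≤ r) {s : ℝ} (hs : |s| ≤ c) : Dominated r c (C s) := by
  simpa using (one hr).C_mul s hs

lemma pow (hr : 0 ≤ r) (hc : 0 ≤ c) (hV : Dominated r c V) (n : ℕ) :
    Dominated r ((16 * c) ^ n) (V ^ n) := by
  induction n with
  | zero => simpa using one hr
  | succ n ih =>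
    rw [pow_succ', pow_succ']
    exact hV.mul hr hc ih

/-- The factor `n` expected in a Lipschitz bound for the `n`-th power is absorbed by doubling the
base, so that the bound stays geometric and can be summed against `B n`. -/
lemma pow_sub_pow (hr : 0 ≤ r) (hc : 1 ≤ c) (hd : 0 ≤ d) (hV : Dominated r c V)
    (hW : Dominated r c W) (hVW : Dominated r d (V - W)) (n : ℕ) :
    Dominated r (16 * d * (2 * (16 * c)) ^ n) (V ^ n - W ^ n) := by
  induction n with
  | zero =>
    intro j
    have := weight_nonneg hr j
    simp; positivity
  | succ n ih =>
    have e : V ^ (n + 1) - W ^ (n + 1) = V * (V ^ n - W ^ n) + (V - W) * W ^ n := by ring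
    rw [e]
    refine ((hV.mul hr (by linarith) ih).add
      (hVW.mul hr hd (hW.pow hr (by linarith) n))).mono hr ?_
    have h1 : (16 * c) ^ n ≤ (2 * (16 * c)) ^ n := pow_le_pow_left₀ (by positivity) (by linarith) n
    have h2 : 0 ≤ (2 * (16 * c)) ^ n := by positivity
    have h3 : d * (16 * c) ^ n ≤ d * (2 * (16 * c)) ^ n := by gcongr
    have h4 : d * (2 * (16 * c)) ^ n ≤ c * (d * (2 * (16 * c)) ^ n) := by
      nlinarith [mul_nonneg hd h2]
    rw [pow_succ]
    nlinarith

/-- The remainder of the first order Taylor expansion of `v ↦ v ^ n` at a constant. -/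
lemma pow_sub_linear (hr : 0 ≤ r) {s : ℝ} (hc : 1 ≤ c) (hd : 0 ≤ d) (hV : Dominated r c V)
    (hs : |s| ≤ c) (hVs : Dominated r d (V - C s)) (n : ℕ) :
    Dominated r ((16 * d) ^ 2 * (2 * (16 * c)) ^ n)
      (V ^ n - C s ^ n - C (n * s ^ (n - 1)) * (V - C s)) := by
  induction n with
  | zero =>
    intro j
    have := weight_nonneg hr j
    simp; positivity
  | succ n ih =>
    -- The new remainder is `s` times the old one plus a product of two differences, which is
    -- quadratic in `d`.
    have e : V ^ (n + 1) - C s ^ (n + 1) - C (((n + 1 : ℕ) : ℝ) * s ^ (n + 1 - 1)) * (V - C s) =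
        C s * (V ^ n - C s ^ n - C (n * s ^ (n - 1)) * (V - C s))
          + (V - C s) * (V ^ n - C s ^ n) := by
      rcases n with _ | n
      · simp
      · simp only [map_mul, map_pow, map_natCast, Nat.add_sub_cancel]
        push_cast
        ring
    rw [e]
    refine ((ih.C_mul s hs).add (hVs.mul hr hd
      (hV.pow_sub_pow hr hc hd (const hr hs) hVs n))).mono hr ?_
    have h2 : 0 ≤ d ^ 2 * (2 * (16 * c)) ^ n := by positivity
    rw [pow_succ (2 * (16 * c))]
    nlinarith [mul_le_mul_of_nonneg_right hc h2]

lemma summable_abs (hr : 0 ≤ r) (hr1 : r ≤ 1) (hV : Dominated r c V) :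
    Summable fun j => |coeff j V| :=
  Summable.of_nonneg_of_le (fun _ => abs_nonneg _) (fun j => hV j) ((summable_weight hr hr1).mul_left c)

lemma summable (hr : 0 ≤ r) (hr1 : r ≤ 1) (hV : Dominated r c V) :
    Summable fun j => coeff j V := 
  summable_abs_iff.1 (hV.summable_abs hr hr1)

lemma hasSum_mul (hr : 0 ≤ r) (hr1 : r ≤ 1) (hc : 0 ≤ c) (hV : Dominated r c V)
    (hW : Dominated r d W) :
    HasSum (fun j => coeff j (V * W)) ((∑' j, coeff j V) * ∑' j, coeff j W) := by
  have hV' : Summable fun j => ‖coeff j V‖ := hV.summable_abs hr hr1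
  have hW' : Summable fun j => ‖coeff j W‖ := hW.summable_abs hr hr1
  rw [tsum_mul_tsum_eq_tsum_sum_antidiagonal_of_summable_norm hV' hW']
  simp_rw [← coeff_mul]
  exact ((hV.mul hr hc hW).summable hr hr1).hasSum

lemma hasSum_pow (hr : 0 ≤ r) (hr1 : r ≤ 1) (hc : 0 ≤ c) (hV : Dominated r c V) (n : ℕ) :
    HasSum (fun j => coeff j (V ^ n)) ((∑' j, coeff j V) ^ n) := by
  induction n with
  | zero =>
    simp only [pow_zero, coeff_one]
    exact hasSum_ite_eq 0 1
  | succ n ih =>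
    rw [pow_succ', pow_succ', ← ih.tsum_eq]
    exact hV.hasSum_mul hr hr1 hc (hV.pow hr hc n)

end Dominated

lemma coeff_pow_congr {V W : PowerSeries ℝ} {k : ℕ} (h : ∀ i ≤ k, coeff i V = coeff i W) (n : ℕ) :
    ∀ i ≤ k, coeff i (V ^ n) = coeff i (W ^ n) := by
  induction n with
  | zero => simp
  | succ n ih =>
    intro i hi
    rw [pow_succ, pow_succ, coeff_mul, coeff_mul]
    refine Finset.sum_congr rfl fun p hp => ?_
    have := Finset.HasAntidiagonal.mem_antidiagonal.1 hp
    rw [h p.2 (by omega), ih p.1 (by omega)]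

/-- The power series with coefficients `v i` for `i ≤ j` and without terms of higher degree. -/
noncomputable def truncate (j : ℕ) (v : ℕ → ℝ) : PowerSeries ℝ :=
  PowerSeries.mk fun i => if i ≤ j then v i else 0

@[simp] lemma coeff_truncate (j : ℕ) (v : ℕ → ℝ) (i : ℕ) :
    coeff i (truncate j v) = if i ≤ j then v i else 0 := by simp [truncate]

lemma dominated_truncate (j : ℕ) {v : ℕ → ℝ} {b : ℝ} (hv : ∀ i ≤ j, |v i| ≤ b)
    (hb : 0 ≤ b) : Dominated 1 (b * ((j : ℝ) + 1) ^ 2) (truncate j v) := fun i => by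
  rw [coeff_truncate, weight, one_pow]
  split_ifs with h
  · refine (hv i h).trans ?_
    rw [mul_assoc]
    refine le_mul_of_one_le_right hb ?_
    rw [mul_one_div, one_le_div (by positivity)]
    gcongr
  · simp; positivity

/-- The coefficient of the top degree enters the power linearly. -/
lemma coeff_succ_pow (v : ℕ → ℝ) (j n : ℕ) :
    coeff (j + 1) (PowerSeries.mk v ^ n) =
      coeff (j + 1) (truncate j v ^ n) + n * v 0 ^ (n - 1) * v (j + 1) := by
  induction n with
  | zero => simp
  | succ n ih =>
    have h0 : coeff 0 (PowerSeries.mk v ^ n) = v 0 ^ n := by simp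
    have h0' : coeff 0 (truncate j v ^ n) = v 0 ^ n := by
      have : constantCoeff (truncate j v) = v 0 := by
        rw [← coeff_zero_eq_constantCoeff_apply]; simp
      simp [this]
    rw [pow_succ', pow_succ', coeff_mul, coeff_mul,
      Finset.Nat.sum_antidiagonal_eq_sum_range_succ_mk,
      Finset.Nat.sum_antidiagonal_eq_sum_range_succ_mk, Finset.sum_range_succ,
      Finset.sum_range_succ']
    conv_rhs => rw [Finset.sum_range_succ, Finset.sum_range_succ']
    -- The interior terms of the convolution see only degrees at most `j`; the discrepancy sits in
    -- the two extreme terms.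
    have hs : ∀ i ∈ Finset.range j,
        coeff (i + 1) (PowerSeries.mk v) * coeff (j + 1 - (i + 1)) (PowerSeries.mk v ^ n) =
        coeff (i + 1) (truncate j v) * coeff (j + 1 - (i + 1)) (truncate j v ^ n) := by
      intro i hi
      have hi := Finset.mem_range.1 hi
      rw [coeff_truncate, if_pos (by omega), coeff_mk,
        coeff_pow_congr (k := j) (V := PowerSeries.mk v) (W := truncate j v)
          (fun i hi => by simp [hi]) n _ (by omega)]
    dsimp only
    rw [Finset.sum_congr rfl hs]
    simp only [Nat.sub_self, Nat.sub_zero, h0, h0', ih, coeff_truncate, coeff_mk]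
    simp only [zero_le, if_true, Nat.not_succ_le_self, if_false]
    rcases n with _ | n
    · simp
    · simp only [Nat.add_sub_cancel]
      push_cast
      ring

/-- The formal composition of `∑ aₙ uⁿ` with a power series `V`, where the (infinite) sums over `n`
are taken coefficientwise. -/
noncomputable def compose (a : ℕ → ℝ) (V : PowerSeries ℝ) : PowerSeries ℝ :=
  PowerSeries.mk fun k => ∑' n, a n * coeff k (V ^ n)

lemma coeff_compose (a : ℕ → ℝ) (V : PowerSeries ℝ) (k : ℕ) :
    coeff k (compose a V) = ∑' n, a n * coeff k (V ^ n) := by simp [compose]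

lemma coeff_compose_congr (a : ℕ → ℝ) {V W : PowerSeries ℝ} {k : ℕ}
    (h : ∀ i ≤ k, coeff i V = coeff i W) : coeff k (compose a V) = coeff k (compose a W) := by
  simp_rw [coeff_compose, coeff_pow_congr h _ k le_rfl]

lemma coeff_truncate_eq (v : ℕ → ℝ) {i j : ℕ} (h : i ≤ j) :
    coeff i (PowerSeries.mk v) = coeff i (truncate j v) := by simp [h]

/-! ### Composition with an entire function and Adomian polynomials -/

section Entire

variable {a B : ℕ → ℝ} (hab : ∀ n, |a n| ≤ B n) (hB : ∀ u : ℝ, Summable fun n => B n * u ^ n)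

include hab

lemma abs_mul_le_majorant {p : ℕ → ℝ} {e ρ : ℝ} (hp : ∀ n, |p n| ≤ e * ρ ^ n) (n : ℕ) :
    |a n * p n| ≤ e * (B n * ρ ^ n) := by
  rw [abs_mul]
  calc _ ≤ B n * (e * ρ ^ n) :=
        mul_le_mul (hab n) (hp n) (abs_nonneg _) ((abs_nonneg _).trans (hab n))
    _ = _ := by ring

include hB

lemma summable_abs_mul {p : ℕ → ℝ} {e ρ : ℝ} (hp : ∀ n, |p n| ≤ e * ρ ^ n) :
    Summable fun n => |a n * p n| :=
  Summable.of_nonneg_of_le (fun _ => abs_nonneg _) (abs_mul_le_majorant hab hp)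
    ((hB ρ).mul_left e)

lemma summable_mul {p : ℕ → ℝ} {e ρ : ℝ} (hp : ∀ n, |p n| ≤ e * ρ ^ n) :
    Summable fun n => a n * p n := summable_abs_iff.1 (summable_abs_mul hab hB hp)

lemma abs_tsum_mul_le {p : ℕ → ℝ} {e ρ : ℝ} (hp : ∀ n, |p n| ≤ e * ρ ^ n) :
    |∑' n, a n * p n| ≤ e * ∑' n, B n * ρ ^ n := by
  rw [← tsum_mul_left]
  exact tsum_of_norm_bounded (f := fun n => a n * p n) ((hB ρ).mul_left e).hasSum
    (abs_mul_le_majorant hab hp)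

/-- No bound on `V` is needed: degree `k` sees only finitely many coefficients, and a polynomial is
dominated with `r = 1`. -/
lemma summable_compose (V : PowerSeries ℝ) (k : ℕ) :
    Summable fun n => a n * coeff k (V ^ n) := by
  have hV : Dominated 1 ((∑ i ∈ Finset.range (k + 1), |coeff i V|) * ((k : ℝ) + 1) ^ 2)
      (truncate k fun i => coeff i V) := by
    refine dominated_truncate k (fun i hi => ?_) (by positivity)
    exact Finset.single_le_sum (f := fun i => |coeff i V|) (fun _ _ => abs_nonneg _)
      (Finset.mem_range.2 (by omega))
  have e : ∀ n, coeff k (V ^ n) = coeff k ((truncate k fun i => coeff i V) ^ n) := fun n =>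
    coeff_pow_congr (fun i hi => by simp [hi]) n k le_rfl
  simp_rw [e]
  refine summable_mul hab hB (e := weight 1 k) (ρ := 16 *
    ((∑ i ∈ Finset.range (k + 1), |coeff i V|) * ((k : ℝ) + 1) ^ 2)) fun n => ?_
  rw [mul_comm]
  exact hV.pow zero_le_one (by positivity) n k

omit hab hB in
lemma abs_mul_pow_pred_le {u c : ℝ} (hc : 1 ≤ c) (hu : |u| ≤ c) (n : ℕ) :
    |n * u ^ (n - 1)| ≤ 1 * (2 * c) ^ n := by
  rw [abs_mul, abs_pow, Nat.abs_cast, one_mul, mul_pow]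
  have h1 : (n : ℝ) ≤ 2 ^ n := by exact_mod_cast n.lt_two_pow_self.le
  have h2 : |u| ^ (n - 1) ≤ c ^ n :=
    (pow_le_pow_left₀ (abs_nonneg _) hu _).trans (pow_le_pow_right₀ hc (Nat.sub_le n 1))
  gcongr

lemma summable_mul_deriv (u : ℝ) : Summable fun n : ℕ => a n * (n * u ^ (n - 1)) :=
  summable_mul hab hB (abs_mul_pow_pred_le (le_add_of_nonneg_left (abs_nonneg u))
    (le_add_of_nonneg_right zero_le_one))

lemma hasDerivAt_tsum_pow (u : ℝ) :
    HasDerivAt (fun v => ∑' n, a n * v ^ n) (∑' n : ℕ, a n * (n * u ^ (n - 1))) u := by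
  refine hasDerivAt_tsum_of_isPreconnected
    (g := fun n v => a n * v ^ n) (g' := fun n v => a n * (n * v ^ (n - 1)))
    (t := Metric.ball 0 (|u| + 1)) (y₀ := u) ((hB (2 * (|u| + 1))).mul_left 1) Metric.isOpen_ball
    (convex_ball _ _).isPreconnected (fun n v _ => (hasDerivAt_pow n v).const_mul _)
    (fun n v hv => ?_) (by simp) ?_ (by simp)
  · rw [mem_ball_zero_iff] at hv
    exact abs_mul_le_majorant hab (p := fun n => n * v ^ (n - 1))
      (abs_mul_pow_pred_le (le_add_of_nonneg_left (abs_nonneg u)) hv.le) n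
  · refine summable_mul hab hB (e := 1) (ρ := |u|) fun n => ?_
    rw [abs_pow, one_mul]

variable {r c d : ℝ} {V W : PowerSeries ℝ}

lemma dominated_compose (hr : 0 ≤ r) (hc : 0 ≤ c) (hV : Dominated r c V) :
    Dominated r (∑' n, B n * (16 * c) ^ n) (compose a V) := fun k => by
  rw [coeff_compose, mul_comm]
  refine abs_tsum_mul_le hab hB fun n => ?_
  rw [mul_comm]
  exact hV.pow hr hc n k

lemma dominated_compose_sub (hr : 0 ≤ r) (hc : 1 ≤ c) (hd : 0 ≤ d) (hV : Dominated r c V)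
    (hW : Dominated r c W) (hVW : Dominated r d (V - W)) :
    Dominated r (16 * d * ∑' n, B n * (2 * (16 * c)) ^ n) (compose a V - compose a W) :=
  fun k => by
  rw [map_sub, coeff_compose, coeff_compose,
    ← (summable_compose hab hB V k).tsum_sub (summable_compose hab hB W k)]
  simp_rw [← mul_sub]
  rw [mul_right_comm]
  refine abs_tsum_mul_le hab hB fun n => ?_
  rw [mul_right_comm, ← map_sub]
  exact hV.pow_sub_pow hr hc hd hW hVW n k

omit hab hB in
lemma coeff_succ_C (s : ℝ) (j : ℕ) : coeff (j + 1) (C s) = 0 := by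
  rw [coeff_C, if_neg (Nat.succ_ne_zero j)]

/-- If the linear part of `V` at degree `j + 1` vanishes, then the coefficient of the composition
is of second order. -/
lemma abs_coeff_succ_compose_le (hr : 0 ≤ r) {s : ℝ} (hc : 1 ≤ c) (hd : 0 ≤ d)
    (hV : Dominated r c V) (hs : |s| ≤ c) (hVs : Dominated r d (V - C s)) (j : ℕ)
    (hj : coeff (j + 1) V = 0) :
    |coeff (j + 1) (compose a V)| ≤
      (16 * d) ^ 2 * (∑' n, B n * (2 * (16 * c)) ^ n) * weight r (j + 1) := by
  rw [coeff_compose, mul_right_comm]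
  refine abs_tsum_mul_le hab hB fun n => ?_
  rw [mul_right_comm]
  have h := hV.pow_sub_linear hr hc hd hs hVs n (j + 1)
  rwa [map_sub, map_sub, ← map_pow, coeff_succ_C, coeff_C_mul, map_sub, coeff_succ_C, hj, sub_zero,
    sub_zero, mul_zero, sub_zero] at h

omit hab hB in
lemma compose_C (s : ℝ) : compose a (C s) = C (∑' n, a n * s ^ n) := by
  ext k
  rw [coeff_compose, coeff_C]
  simp_rw [← map_pow, coeff_C]
  split_ifs <;> simp

lemma coeff_succ_compose (v : ℕ → ℝ) (j : ℕ) :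
    coeff (j + 1) (compose a (PowerSeries.mk v)) =
      coeff (j + 1) (compose a (truncate j v))
        + (∑' n : ℕ, a n * (n * v 0 ^ (n - 1))) * v (j + 1) := by
  rw [coeff_compose, coeff_compose, ← tsum_mul_right,
    ← (summable_compose hab hB _ _).tsum_add ((summable_mul_deriv hab hB (v 0)).mul_right _)]
  refine tsum_congr fun n => ?_
  rw [coeff_succ_pow]
  ring

/-- Evaluation at `t = 1` commutes with composition: the double series over powers and degrees
converges absolutely and may be summed in either order. -/
lemma hasSum_compose (hr : 0 ≤ r) (hr1 : r ≤ 1) (hc : 0 ≤ c) (hV : Dominated r c V) :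
    HasSum (fun k => coeff k (compose a V)) (∑' n, a n * (∑' j, coeff j V) ^ n) := by
  have hs : Summable fun p : ℕ × ℕ => a p.1 * coeff p.2 (V ^ p.1) := by
    refine Summable.of_norm_bounded (g := fun p : ℕ × ℕ => B p.1 * (16 * c) ^ p.1 * weight r p.2)
      ((hB (16 * c)).mul_of_nonneg (summable_weight hr hr1)
        (fun n => mul_nonneg ((abs_nonneg _).trans (hab n)) (by positivity))
        (weight_nonneg hr)) fun p => ?_
    rw [Real.norm_eq_abs, abs_mul, mul_assoc]
    exact mul_le_mul (hab _) (hV.pow hr hc _ _) (abs_nonneg _) ((abs_nonneg _).trans (hab _))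
  have h1 := hs.hasSum.prod_fiberwise fun n => (hV.hasSum_pow hr hr1 hc n).mul_left (a n)
  rw [h1.tsum_eq]
  have h2 := (Equiv.prodComm ℕ ℕ).hasSum_iff.2 hs.hasSum
  refine h2.prod_fiberwise fun k => ?_
  rw [coeff_compose]
  exact (summable_compose hab hB V k).hasSum

/-- The Adomian polynomials are the coefficients of the formal composition. -/
lemma adomian_eq_coeff {f : ℝ → ℝ} (hf : ∀ u, HasSum (fun n => a n * u ^ n) (f u)) (k : ℕ)
    (v : ℕ → ℝ) : adomian k f v = coeff k (compose a (PowerSeries.mk v)) := by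
  set T := truncate k v with hT
  have hTd : Dominated 1 ((∑ i ∈ Finset.range (k + 1), |v i|) * ((k : ℝ) + 1) ^ 2) T := by
    refine dominated_truncate k (fun i hi => ?_) (by positivity)
    exact Finset.single_le_sum (f := fun i => |v i|) (fun _ _ => abs_nonneg _)
      (Finset.mem_range.2 (by omega))
  set g : ℝ → ℝ := fun t => f (∑ i ∈ Finset.range (k + 1), t ^ i * v i) with hg
  have hps : HasFPowerSeriesAt g
      (FormalMultilinearSeries.ofScalars ℝ fun n => coeff n (compose a T)) 0 := by
    rw [hasFPowerSeriesAt_iff]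
    filter_upwards [Metric.ball_mem_nhds (0 : ℝ) one_pos] with t ht
    rw [mem_ball_zero_iff, Real.norm_eq_abs] at ht
    -- For `|t| < 1` rescaling by `t` keeps the domination, so evaluating at 1 gives the value of
    -- `g` at `t`.
    have hd : Dominated 1 ((∑ i ∈ Finset.range (k + 1), |v i|) * ((k : ℝ) + 1) ^ 2)
        (rescale t T) := fun j => by
      rw [coeff_rescale, abs_mul, abs_pow]
      exact (mul_le_of_le_one_left (abs_nonneg _) (pow_le_one₀ (abs_nonneg t) ht.le)).trans (hTd j)
    have h := hasSum_compose hab hB zero_le_one le_rfl (by positivity) hd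
    have e : ∑' j, coeff j (rescale t T) = ∑ i ∈ Finset.range (k + 1), t ^ i * v i := by
      rw [tsum_eq_sum (s := Finset.range (k + 1))]
      · refine Finset.sum_congr rfl fun i hi => ?_
        rw [coeff_rescale, hT, coeff_truncate, if_pos (by have := Finset.mem_range.1 hi; omega)]
      · intro i hi
        rw [coeff_rescale, hT, coeff_truncate, if_neg (by rw [Finset.mem_range] at hi; omega),
          mul_zero]
    rw [e, (hf _).tsum_eq] at h
    simp only [FormalMultilinearSeries.coeff_ofScalars, zero_add, smul_eq_mul]
    have e2 : (fun n => t ^ n * coeff n (compose a T)) =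
        fun n => coeff n (compose a (rescale t T)) := by
      ext n
      rw [coeff_compose, coeff_compose, ← tsum_mul_left]
      refine tsum_congr fun m => ?_
      rw [← map_pow, coeff_rescale]
      ring
    rw [e2]
    exact h
  -- Uniqueness of the power series identifies its coefficients with the Taylor coefficients of `g`.
  have h2 := hps.eq_formalMultilinearSeries hps.analyticAt.hasFPowerSeriesAt
  have h3 := congrArg (fun p => FormalMultilinearSeries.coeff p k) h2
  simp only [FormalMultilinearSeries.coeff_ofScalars] at h3
  rw [adomian, ← h3]
  exact (coeff_compose_congr a fun i hi => coeff_truncate_eq v hi).symm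

end Entire

lemma continuousOn_coeff_pow {s : Set ℝ} {V : ℝ → PowerSeries ℝ} {k : ℕ}
    (hV : ∀ i ≤ k, ContinuousOn (fun x => coeff i (V x)) s) (n : ℕ) :
    ∀ i ≤ k, ContinuousOn (fun x => coeff i (V x ^ n)) s := by
  induction n with
  | zero => intro i _; simpa using continuousOn_const
  | succ n ih =>
    intro i hi
    simp_rw [pow_succ, coeff_mul]
    refine continuousOn_finsetSum _ fun p hp => ?_
    have := Finset.HasAntidiagonal.mem_antidiagonal.1 hp
    exact (ih p.1 (by omega)).mul (hV p.2 (by omega))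

section Continuity

variable {a : ℕ → ℝ → ℝ} {B : ℕ → ℝ} {s : Set ℝ} (ha : ∀ n, ContinuousOn (a n) s)
  (hab : ∀ n, ∀ x ∈ s, |a n x| ≤ B n) (hB : ∀ u : ℝ, Summable fun n => B n * u ^ n)

include ha hab hB

lemma continuousOn_tsum_mul {p : ℕ → ℝ → ℝ} {e ρ : ℝ} (hp : ∀ n, ContinuousOn (p n) s)
    (hpb : ∀ n, ∀ x ∈ s, |p n x| ≤ e * ρ ^ n) :
    ContinuousOn (fun x => ∑' n, a n x * p n x) s := by
  refine continuousOn_tsum (fun n => (ha n).mul (hp n)) ((hB ρ).mul_left e) fun n x hx => ?_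
  rw [Real.norm_eq_abs, abs_mul]
  calc _ ≤ B n * (e * ρ ^ n) :=
        mul_le_mul (hab n x hx) (hpb n x hx) (abs_nonneg _) ((abs_nonneg _).trans (hab n x hx))
    _ = _ := by ring

lemma continuousOn_coeff_compose {v : ℕ → ℝ → ℝ} {k : ℕ} {b : ℝ} (hb : 0 ≤ b)
    (hv : ∀ i ≤ k, ContinuousOn (v i) s) (hvb : ∀ i ≤ k, ∀ x ∈ s, |v i x| ≤ b) :
    ContinuousOn (fun x => coeff k (compose (fun n => a n x) (PowerSeries.mk fun i => v i x))) s := by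
  have e : ∀ x, coeff k (compose (fun n => a n x) (PowerSeries.mk fun i => v i x)) =
      coeff k (compose (fun n => a n x) (truncate k fun i => v i x)) := fun x =>
    coeff_compose_congr _ fun i hi => coeff_truncate_eq _ hi
  simp_rw [e, coeff_compose]
  refine continuousOn_tsum_mul ha hab hB (e := weight 1 k)
    (ρ := 16 * (b * ((k : ℝ) + 1) ^ 2)) (fun n => ?_) (fun n x hx => ?_)
  · refine continuousOn_coeff_pow (fun i hi => ?_) n k le_rfl
    simpa [hi] using hv i hi
  · rw [mul_comm]
    exact (dominated_truncate k (fun i hi => hvb i hi x hx) hb).pow zero_le_one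
      (by positivity) n k

end Continuity

end PowerSeries

/-! ### Linear equations, one grid interval after another -/

lemma exists_linear_ode_solution {p q : ℝ} (hpq : p ≤ q) {a g : ℝ → ℝ}
    (ha : ContinuousOn a (Icc p q)) (hg : ContinuousOn g (Icc p q)) (y₀ : ℝ) :
    ∃ y : ℝ → ℝ, y p = y₀ ∧
      ∀ x ∈ Icc p q, HasDerivWithinAt y (a x * y x + g x) (Icc p q) x := by
  -- Extending the coefficients continuously to the line lets variation of constants be
  -- differentiated without boundary cases.
  set a' := IccExtend hpq ((Icc p q).domRestrict a)
  set g' := IccExtend hpq ((Icc p q).domRestrict g)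
  have ha' : Continuous a' := ha.domRestrict.Icc_extend'
  have hg' : Continuous g' := hg.domRestrict.Icc_extend'
  have hA : ∀ x, HasDerivAt (fun x => ∫ t in p..x, a' t) (a' x) x := fun x =>
    (ha'.integral_hasStrictDerivAt p x).hasDerivAt
  have hAc : Continuous fun x => ∫ t in p..x, a' t :=
    continuous_iff_continuousAt.2 fun x => (hA x).continuousAt
  have hG : ∀ x, HasDerivAt (fun x => ∫ t in p..x, Real.exp (-∫ s in p..t, a' s) * g' t)
      (Real.exp (-∫ s in p..x, a' s) * g' x) x := fun x =>
    (Continuous.integral_hasStrictDerivAt (by fun_prop) p x).hasDerivAt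
  refine ⟨fun x => Real.exp (∫ t in p..x, a' t) *
    (y₀ + ∫ t in p..x, Real.exp (-∫ s in p..t, a' s) * g' t), by simp, fun x hx => ?_⟩
  have h := (hA x).exp.mul ((hG x).const_add y₀)
  refine (h.congr_deriv ?_).hasDerivWithinAt
  have e1 : a' x = a x := IccExtend_of_mem hpq _ hx
  have e2 : g' x = g x := IccExtend_of_mem hpq _ hx
  rw [← e1, ← e2, ← mul_assoc, ← Real.exp_add, add_neg_cancel, Real.exp_zero]
  ring

namespace Grid

variable {x₀ : ℝ} (G : Grid x₀)

lemma le_node (i : ℕ) : x₀ ≤ G.node i := by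
  calc x₀ = G.node 0 := G.node_zero.symm
    _ ≤ G.node i := G.node_strictMono.monotone (Nat.zero_le i)

lemma node_lt_succ (i : ℕ) : G.node i < G.node (i + 1) := G.node_strictMono (Nat.lt_succ_self i)

lemma Icc_subset_Ici (i : ℕ) : Icc (G.node i) (G.node (i + 1)) ⊆ Ici x₀ := fun _ hx =>
  (G.le_node i).trans hx.1

lemma exists_lt_node (x : ℝ) : ∃ i, x < G.node (i + 1) := by
  obtain ⟨i, hi⟩ := (G.node_tendsto.eventually_gt_atTop x).exists
  exact ⟨i, hi.trans (G.node_lt_succ i)⟩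

open Classical in
/-- The index of the grid interval that contains `x`. -/
noncomputable def index (x : ℝ) : ℕ := Nat.find (G.exists_lt_node x)

lemma index_eq {x : ℝ} {i : ℕ} (hx : x ∈ Ico (G.node i) (G.node (i + 1))) : G.index x = i := by
  classical
  rw [index, Nat.find_eq_iff]
  exact ⟨hx.2, fun n hn => not_lt.2 ((G.node_strictMono.monotone hn).trans hx.1)⟩

lemma mem_index {x : ℝ} (hx : x₀ ≤ x) :
    x ∈ Ico (G.node (G.index x)) (G.node (G.index x + 1)) := by
  classical
  refine ⟨?_, Nat.find_spec (G.exists_lt_node x)⟩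
  rcases h : G.index x with _ | n
  · rwa [G.node_zero]
  · exact not_lt.1 (Nat.find_min (G.exists_lt_node x) (m := n) (by
      have : Nat.find (G.exists_lt_node x) = n + 1 := h
      omega))

lemma continuousOn_Ici {y : ℝ → ℝ}
    (hy : ∀ i, ContinuousOn y (Icc (G.node i) (G.node (i + 1)))) : ContinuousOn y (Ici x₀) := by
  have h : ∀ n, ContinuousOn y (Icc x₀ (G.node n)) := by
    intro n
    induction n with
    | zero => rw [G.node_zero, Icc_self]; exact continuousOn_singleton _ _
    | succ n ih =>
      rw [← Icc_union_Icc_eq_Icc (G.le_node n) (G.node_lt_succ n).le]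
      exact ih.union_of_isClosed (hy n) isClosed_Icc isClosed_Icc
  intro x hx
  obtain ⟨i, hi⟩ := G.exists_lt_node x
  refine (h (i + 1) x ⟨hx, hi.le⟩).mono_of_mem_nhdsWithin ?_
  rw [← Ici_inter_Iic]
  exact inter_mem self_mem_nhdsWithin (mem_nhdsWithin_of_mem_nhds (Iic_mem_nhds hi))

/-- Linear problems on the grid intervals, whose coefficients may depend on the value of the
solution at the left end point, can be solved successively. -/
lemma exists_piecewise_linear_ode_solution {A g : ℕ → ℝ → ℝ → ℝ}
    (hA : ∀ i c, ContinuousOn (A i c) (Icc (G.node i) (G.node (i + 1))))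
    (hg : ∀ i c, ContinuousOn (g i c) (Icc (G.node i) (G.node (i + 1)))) (y₀ : ℝ) :
    ∃ y : ℝ → ℝ, ContinuousOn y (Ici x₀) ∧ y x₀ = y₀ ∧
      ∀ i, ∀ x ∈ Icc (G.node i) (G.node (i + 1)),
        HasDerivWithinAt y (A i (y (G.node i)) x * y x + g i (y (G.node i)) x)
          (Icc (G.node i) (G.node (i + 1))) x := by
  choose s hs0 hs using fun i c =>
    exists_linear_ode_solution (G.node_lt_succ i).le (hA i c) (hg i c) c
  -- `c i` is the nodal value handed to the `i`-th interval.
  let c : ℕ → ℝ := fun n => Nat.rec y₀ (fun i ci => s i ci (G.node (i + 1))) n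
  have hc : ∀ i, c (i + 1) = s i (c i) (G.node (i + 1)) := fun _ => rfl
  let y : ℝ → ℝ := fun x => s (G.index x) (c (G.index x)) x
  have hy : ∀ i, ∀ x ∈ Ico (G.node i) (G.node (i + 1)), y x = s i (c i) x := fun i x hx => by
    simp only [y, G.index_eq hx]
  have hyn : ∀ i, y (G.node i) = c i := fun i => by
    rw [hy i _ ⟨le_rfl, G.node_lt_succ i⟩, hs0]
  have hy' : ∀ i, ∀ x ∈ Icc (G.node i) (G.node (i + 1)), y x = s i (c i) x := fun i x hx => by
    rcases hx.2.lt_or_eq with h | h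
    · exact hy i x ⟨hx.1, h⟩
    · rw [h, hyn, hc]
  have hd : ∀ i, ∀ x ∈ Icc (G.node i) (G.node (i + 1)),
        HasDerivWithinAt y (A i (y (G.node i)) x * y x + g i (y (G.node i)) x)
          (Icc (G.node i) (G.node (i + 1))) x := fun i x hx => by
    rw [hyn, hy' i x hx]
    exact (hs i (c i) x hx).congr (hy' i) (hy' i x hx)
  refine ⟨y, G.continuousOn_Ici fun i x hx => (hd i x hx).continuousWithinAt, ?_, hd⟩
  have := hyn 0
  rwa [G.node_zero] at this

end Grid

/-! ### Existence of the terms -/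

lemma adomian_congr {k : ℕ} {f : ℝ → ℝ} {v w : ℕ → ℝ} (h : ∀ i ≤ k, v i = w i) :
    adomian k f v = adomian k f w := by
  unfold adomian
  congr 2
  ext t
  congr 1
  exact Finset.sum_congr rfl fun i hi => by
    rw [h i (Nat.lt_succ_iff.1 (Finset.mem_range.1 hi))]

lemma rhsF_congr {N : ℝ → ℝ → ℝ} {U W : ℕ → ℝ → ℝ} {j : ℕ} (h : ∀ i ≤ j, U i = W i) (xl x : ℝ) :
    rhsF N U xl j x = rhsF N W xl j x := by
  unfold rhsF
  congr 1
  · congr 1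
    · refine Finset.sum_congr rfl fun p hp => ?_
      obtain ⟨h1, h2⟩ := Finset.mem_Icc.1 hp
      rw [h p h2, adomian_congr fun i hi => by rw [h i (by omega)]]
    · refine Finset.sum_congr rfl fun p hp => ?_
      have hp := Finset.mem_range.1 hp
      rw [h p (by omega), adomian_congr (w := fun i => W i x) fun i hi => by rw [h i (by omega)],
        adomian_congr (v := fun i => U i xl) (w := fun i => W i xl)
          fun i hi => by rw [h i (by omega)]]
  · rw [h 0 (Nat.zero_le j)]
    congr 1
    refine adomian_congr fun i _ => ?_
    split_ifs with hi
    · rw [h i hi]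
    · rfl

section Nonlinearity

variable {x₀ : ℝ} {N : ℝ → ℝ → ℝ} {a : ℕ → ℝ → ℝ} {B : ℕ → ℝ}
  (ha_cont : ∀ i, ContinuousOn (a i) (Ici x₀))
  (hN : ∀ x ∈ Ici x₀, ∀ u : ℝ, HasSum (fun i : ℕ => a i x * u ^ i) (N x u))
  (haB : ∀ i, ∀ x ∈ Ici x₀, |a i x| ≤ B i)
  (hB : ∀ u : ℝ, Summable fun i : ℕ => B i * u ^ i)

include hN haB hB

lemma hasDerivAt_nonlinearity {x : ℝ} (hx : x ∈ Ici x₀) (u : ℝ) :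
    HasDerivAt (N x) (∑' n : ℕ, a n x * (n * u ^ (n - 1))) u := by
  have e : N x = fun v => ∑' n, a n x * v ^ n := funext fun v => (hN x hx v).tsum_eq.symm
  rw [e]
  exact hasDerivAt_tsum_pow (fun n => haB n x hx) hB u

lemma adomian_nonlinearity {x : ℝ} (hx : x ∈ Ici x₀) (k : ℕ) (v : ℕ → ℝ) :
    adomian k (N x) v = PowerSeries.coeff k (compose (fun n => a n x) (PowerSeries.mk v)) :=
  adomian_eq_coeff (fun n => haB n x hx) hB (hN x hx) k v

include ha_cont

lemma continuousOn_nonlinearity {b : ℝ} {s : Set ℝ} (hs : s ⊆ Ici x₀) {u : ℝ → ℝ}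
    (hu : ContinuousOn u s) (hub : ∀ x ∈ s, |u x| ≤ b) :
    ContinuousOn (fun x => N x (u x)) s := by
  have e : EqOn (fun x => N x (u x)) (fun x => ∑' n, a n x * u x ^ n) s := fun x hx =>
    (hN x (hs hx) _).tsum_eq.symm
  refine ContinuousOn.congr ?_ e
  refine continuousOn_tsum_mul (fun n => (ha_cont n).mono hs) (fun n x hx => haB n x (hs hx)) hB
    (e := 1) (ρ := b) (fun n => hu.pow n) fun n x hx => ?_
  rw [abs_pow, one_mul]
  exact pow_le_pow_left₀ (abs_nonneg _) (hub x hx) n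

lemma continuousOn_deriv_nonlinearity (c : ℝ) :
    ContinuousOn (fun x => deriv (N x) c) (Ici x₀) := by
  have e : EqOn (fun x => deriv (N x) c) (fun x => ∑' n : ℕ, a n x * (n * c ^ (n - 1))) (Ici x₀) :=
    fun x hx => (hasDerivAt_nonlinearity hN haB hB hx c).deriv
  refine ContinuousOn.congr ?_ e
  exact continuousOn_tsum_mul ha_cont haB hB (fun n => continuousOn_const) fun n x _ =>
    abs_mul_pow_pred_le (le_add_of_nonneg_left (abs_nonneg c))
      (le_add_of_nonneg_right zero_le_one) n

lemma continuousOn_adomian {s : Set ℝ} (hsc : IsCompact s) (hs : s ⊆ Ici x₀) {k : ℕ}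
    {v : ℕ → ℝ → ℝ} (hv : ∀ i ≤ k, ContinuousOn (v i) s) :
    ContinuousOn (fun x => adomian k (N x) fun i => v i x) s := by
  have hb : ∀ i, ∃ b, i ≤ k → ∀ x ∈ s, |v i x| ≤ b := fun i => by
    by_cases h : i ≤ k
    · obtain ⟨b, hb⟩ := hsc.exists_bound_of_continuousOn (hv i h)
      exact ⟨b, fun _ => hb⟩
    · exact ⟨0, fun h' => absurd h' h⟩
  choose b hb using hb
  refine ContinuousOn.congr ?_ fun x hx => adomian_nonlinearity hN haB hB (hs hx) k _
  refine continuousOn_coeff_compose (fun n => (ha_cont n).mono hs) (fun n x hx => haB n x (hs hx))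
    hB (b := ∑ i ∈ Finset.range (k + 1), |b i|) (by positivity) hv fun i hi x hx => ?_
  exact ((hb i hi x hx).trans (le_abs_self _)).trans
    (Finset.single_le_sum (f := fun i => |b i|) (fun _ _ => abs_nonneg _)
      (Finset.mem_range.2 (by omega)))

lemma continuousOn_rhsF {s : Set ℝ} (hsc : IsCompact s) (hs : s ⊆ Ici x₀) {j : ℕ}
    {U : ℕ → ℝ → ℝ} (hU : ∀ i ≤ j, ContinuousOn (U i) s) (xl : ℝ) :
    ContinuousOn (rhsF N U xl j) s := by
  unfold rhsF
  refine ContinuousOn.add (ContinuousOn.add ?_ ?_) ?_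
  · refine continuousOn_finsetSum _ fun p hp => ?_
    exact (continuousOn_adomian ha_cont hN haB hB hsc hs (v := fun i _ => U i xl)
      fun i _ => continuousOn_const).mul (hU p (Finset.mem_Icc.1 hp).2)
  · refine continuousOn_finsetSum _ fun p hp => ?_
    have hp := Finset.mem_range.1 hp
    refine ContinuousOn.mul (ContinuousOn.sub ?_ ?_) (hU p (by omega))
    · exact continuousOn_adomian ha_cont hN haB hB hsc hs fun i hi => hU i (by omega)
    · exact continuousOn_adomian ha_cont hN haB hB hsc hs (v := fun i _ => U i xl)
        fun i _ => continuousOn_const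
  · exact (continuousOn_adomian ha_cont hN haB hB hsc hs (v := fun i _ => if i ≤ j then U i xl else 0)
      fun i _ => continuousOn_const).mul (hU 0 (Nat.zero_le j))

theorem exists_isFDTerms (u₀ : ℝ) {φ : ℝ → ℝ} (hφ_cont : ContinuousOn φ (Ici x₀)) (G : Grid x₀) :
    ∃ U : ℕ → ℝ → ℝ, IsFDTerms u₀ N φ G U := by
  obtain ⟨Y, hYc, hY0, hYd⟩ := G.exists_piecewise_linear_ode_solution
    (A := fun _ c x => N x c) (g := fun _ _ x => φ x)
    (fun i c => continuousOn_nonlinearity ha_cont hN haB hB (G.Icc_subset_Ici i)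
      continuousOn_const (b := |c|) fun _ _ => le_rfl)
    (fun i _ => hφ_cont.mono (G.Icc_subset_Ici i)) u₀
  -- The continuity hypothesis stands inside the existential so that `choose` yields a total
  -- successor function.
  have step : ∀ (j : ℕ) (U : ℕ → ℝ → ℝ), ∃ y : ℝ → ℝ, (∀ i ≤ j, ContinuousOn (U i) (Ici x₀)) →
      ContinuousOn y (Ici x₀) ∧ y x₀ = 0 ∧
      ∀ i : ℕ, ∀ x ∈ Icc (G.node i) (G.node (i + 1)),
        HasDerivWithinAt y (N x (U 0 (G.node i)) * y x
          + (deriv (N x) (U 0 (G.node i)) * U 0 x * y (G.node i) + rhsF N U (G.node i) j x))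
        (Icc (G.node i) (G.node (i + 1))) x := by
    intro j U
    by_cases hU : ∀ i ≤ j, ContinuousOn (U i) (Ici x₀)
    · obtain ⟨y, hy⟩ := G.exists_piecewise_linear_ode_solution
        (A := fun i _ x => N x (U 0 (G.node i)))
        (g := fun i c x => deriv (N x) (U 0 (G.node i)) * U 0 x * c + rhsF N U (G.node i) j x)
        (fun i c => continuousOn_nonlinearity ha_cont hN haB hB (G.Icc_subset_Ici i)
          continuousOn_const (b := |U 0 (G.node i)|) fun _ _ => le_rfl)
        (fun i c => ((((continuousOn_deriv_nonlinearity ha_cont hN haB hB _).mul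
          (hU 0 (Nat.zero_le j))).mul continuousOn_const).mono (G.Icc_subset_Ici i)).add
          (continuousOn_rhsF ha_cont hN haB hB isCompact_Icc (G.Icc_subset_Ici i)
            (fun i' hi' => (hU i' hi').mono (G.Icc_subset_Ici i)) _)) 0
      exact ⟨y, fun _ => hy⟩
    · exact ⟨0, fun h => absurd h hU⟩
  choose next hnext using step
  -- Each term depends on all earlier ones, so the recursion carries a whole sequence, correct up to
  -- index `n`; the diagonal is the answer.
  let S : ℕ → ℕ → ℝ → ℝ := fun n =>
    Nat.rec (fun _ => Y) (fun j Sj => Function.update Sj (j + 1) (next j Sj)) n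
  have hS : ∀ n, S (n + 1) = Function.update (S n) (n + 1) (next n (S n)) := fun _ => rfl
  have hSdiag : ∀ n, ∀ i ≤ n, S i i = S n i := by
    intro n
    induction n with
    | zero => intro i hi; rw [Nat.le_zero.1 hi]
    | succ n ih =>
      intro i hi
      rcases hi.lt_or_eq with h | h
      · rw [hS, Function.update_of_ne (by omega), ih i (by omega)]
      · rw [h]
  have hSn : ∀ n, S (n + 1) (n + 1) = next n (S n) := fun n => by
    rw [hS, Function.update_self]
  have hcont : ∀ n, ∀ i ≤ n, ContinuousOn (S n i) (Ici x₀) := by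
    intro n
    induction n with
    | zero => intro i _; exact hYc
    | succ n ih =>
      intro i hi
      rcases hi.lt_or_eq with h | h
      · rw [hS, Function.update_of_ne (by omega)]; exact ih i (by omega)
      · rw [h, hSn]; exact (hnext n (S n) ih).1
  refine ⟨fun n => S n n, fun j => hcont j j le_rfl, hY0, fun j => ?_, hYd, fun j i x hx => ?_⟩
  · rw [hSn]
    exact (hnext j (S j) (hcont j)).2.1
  · have h := (hnext j (S j) (hcont j)).2.2 i x hx
    rw [hSn, rhsF_congr (W := S j) (fun i hi => hSdiag j i hi), hSdiag j 0 (Nat.zero_le j), add_assoc]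
    exact h

end Nonlinearity

/-! ### Barrier estimates -/

section Barrier

/-- A function whose derivative is negative wherever it meets a level from below stays below that
level. -/
lemma le_of_deriv_neg_of_eq {p q s : ℝ} {y y' : ℝ → ℝ}
    (hy : ∀ x ∈ Icc p q, HasDerivWithinAt y (y' x) (Icc p q) x) (hp : y p ≤ s)
    (hs : ∀ x ∈ Icc p q, y x = s → y' x < 0) : ∀ x ∈ Icc p q, y x ≤ s := fun x hx => by
  refine image_le_of_deriv_right_lt_deriv_boundary' (f' := y') (B := fun _ => s) (B' := fun _ => 0)
    (fun x hx => (hy x hx).continuousWithinAt)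
    (fun x hx => ?_) hp continuousOn_const (fun x _ => hasDerivWithinAt_const _ _ _)
    (fun x hx => hs x (Ico_subset_Icc_self hx)) hx
  exact (hy x (Ico_subset_Icc_self hx)).mono_of_mem_nhdsWithin (Icc_mem_nhdsGE_of_mem hx)

/-- A bound for linear dissipative equations: `y' = a y + f` with `a ≤ -α` and `|f| < α s`. -/
lemma abs_le_of_dissipative {p q s α : ℝ} {y a f : ℝ → ℝ}
    (hy : ∀ x ∈ Icc p q, HasDerivWithinAt y (a x * y x + f x) (Icc p q) x) (hs : 0 ≤ s)
    (ha : ∀ x ∈ Icc p q, a x ≤ -α) (hf : ∀ x ∈ Icc p q, |f x| < α * s) (hp : |y p| ≤ s) :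
    ∀ x ∈ Icc p q, |y x| ≤ s := by
  intro x hx
  refine abs_le'.2 ⟨?_, ?_⟩
  · refine le_of_deriv_neg_of_eq hy (le_of_abs_le hp) (fun x hx h => ?_) x hx
    have h1 := ha x hx
    have h2 := (abs_lt.1 (hf x hx)).2
    rw [h]
    nlinarith
  · refine le_of_deriv_neg_of_eq (y := fun x => -y x) (fun x hx => (hy x hx).neg)
      ((neg_le_abs _).trans hp) (fun x hx h => ?_) x hx
    have h1 := ha x hx
    have h2 := (abs_lt.1 (hf x hx)).1
    have h3 : y x = -s := by linarith
    rw [h3]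
    nlinarith

/-- A bound on one step for linear problems with a frozen argument: the step is small, and the
sum of the two coefficients is negative. -/
lemma abs_le_of_frozen {p q s α P : ℝ} {y a b f : ℝ → ℝ}
    (hy : ∀ x ∈ Icc p q, HasDerivWithinAt y (a x * y x + b x * y p + f x) (Icc p q) x)
    (hs : 0 < s) (hα : 0 < α) (hαP : α ≤ P) (ha : ∀ x ∈ Icc p q, a x ≤ 0)
    (haP : ∀ x ∈ Icc p q, |a x| ≤ P) (hbP : ∀ x ∈ Icc p q, |b x| ≤ P)
    (hab : ∀ x ∈ Icc p q, a x + b x ≤ -(α / 2)) (hf : ∀ x ∈ Icc p q, |f x| ≤ α / 4 * s)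
    (hpq : p ≤ q) (hstep : 2 * P * (q - p) ≤ 1) (hstep' : 16 * P ^ 2 * (q - p) < α)
    (hp : |y p| ≤ s) : ∀ x ∈ Icc p q, |y x| ≤ s := by
  have hP : 0 < P := hα.trans_le hαP
  -- an upper bound for a function satisfying the one-sided inequality
  have crude : ∀ z : ℝ → ℝ, ∀ g : ℝ → ℝ,
      (∀ x ∈ Icc p q, HasDerivWithinAt z (a x * z x + b x * z p + g x) (Icc p q) x) →
      (∀ x ∈ Icc p q, |g x| ≤ α / 4 * s) → |z p| ≤ s → ∀ x ∈ Icc p q, z x ≤ 2 * s := by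
    intro z g hz hg hzp x hx
    -- A line of slope `2 P s` is a barrier: where `z` is positive, `a z ≤ 0`, and the other two
    -- terms together stay below `2 P s`.
    have h : z x - 2 * P * s * (x - p) ≤ s := by
      refine le_of_deriv_neg_of_eq (y := fun x => z x - 2 * P * s * (x - p))
        (fun x hx => (hz x hx).sub
          (((hasDerivAt_id x).sub_const p).const_mul (2 * P * s)).hasDerivWithinAt)
        (by simpa using le_of_abs_le hzp) (fun x hx h => ?_) x hx
      have hzx : 0 < z x := by
        have : 0 ≤ 2 * P * s * (x - p) := by
          have := sub_nonneg.2 hx.1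
          positivity
        linarith
      have h1 : a x * z x ≤ 0 := mul_nonpos_of_nonpos_of_nonneg (ha x hx) hzx.le
      have h2 : b x * z p ≤ P * s := by
        refine (le_abs_self _).trans ?_
        rw [abs_mul]
        exact mul_le_mul (hbP x hx) hzp (abs_nonneg _) hP.le
      have h3 : g x ≤ α / 4 * s := le_of_abs_le (hg x hx)
      have h4 : α / 4 * s < P * s := by nlinarith
      linarith
    have h5 : 2 * P * s * (x - p) ≤ s := by
      have : 2 * P * (x - p) ≤ 1 := 
        (mul_le_mul_of_nonneg_left (sub_le_sub_right hx.2 p) (by positivity)).trans hstep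
      nlinarith
    linarith
  have hyabs : ∀ x ∈ Icc p q, |y x| ≤ 2 * s := fun x hx => by
    refine abs_le'.2 ⟨crude y f hy hf hp x hx, ?_⟩
    refine crude (fun x => -y x) (fun x => -f x) (fun x hx => ?_) (by simpa using hf)
      (by simpa using hp) x hx
    exact (hy x hx).neg.congr_deriv (by ring)
  have hbound : ∀ x ∈ Icc p q, |a x * y x + b x * y p + f x| ≤ 4 * P * s := fun x hx => by
    have h1 : |a x * y x| ≤ P * (2 * s) := by
      rw [abs_mul]; exact mul_le_mul (haP x hx) (hyabs x hx) (abs_nonneg _) hP.le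
    have h2 : |b x * y p| ≤ P * s := by
      rw [abs_mul]; exact mul_le_mul (hbP x hx) hp (abs_nonneg _) hP.le
    have h3 := hf x hx
    have h4 : α / 4 * s ≤ P * s := by nlinarith
    linarith [abs_add_le (a x * y x + b x * y p) (f x), abs_add_le (a x * y x) (b x * y p)]
  have hosc : ∀ x ∈ Icc p q, |y x - y p| ≤ 4 * P * s * (q - p) := fun x hx => by
    have h := Convex.norm_image_sub_le_of_norm_hasDerivWithin_le (x := p) (y := x) hy
      (fun x hx => hbound x hx) (convex_Icc p q) (left_mem_Icc.2 hpq) hx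
    rw [Real.norm_eq_abs, Real.norm_eq_abs, abs_of_nonneg (sub_nonneg.2 hx.1)] at h
    refine h.trans ?_
    gcongr
    exact hx.2
  -- Writing `y p = y x + (y p - y x)` turns the equation into a dissipative one with coefficient `a
  -- + b`; the oscillation over the short step is absorbed into the source.
  have hrem : ∀ x ∈ Icc p q, |b x * (y p - y x) + f x| < α / 2 * s := fun x hx => by
    have h1 : |b x * (y p - y x)| ≤ P * (4 * P * s * (q - p)) := by
      rw [abs_mul, abs_sub_comm]
      exact mul_le_mul (hbP x hx) (hosc x hx) (abs_nonneg _) hP.le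
    have h2 := hf x hx
    have h3 : P * (4 * P * s * (q - p)) < α / 4 * s := by nlinarith
    linarith [abs_add_le (b x * (y p - y x)) (f x)]
  refine abs_le_of_dissipative (a := fun x => a x + b x) (f := fun x => b x * (y p - y x) + f x)
    (fun x hx => (hy x hx).congr_deriv (by ring)) hs.le hab hrem hp

end Barrier

/-! ### Dissipativity and uniqueness -/

section Dissipative

variable {x₀ α : ℝ} {N : ℝ → ℝ → ℝ}
  (hmono : ∀ x ∈ Ici x₀, ∀ u : ℝ, deriv (fun v : ℝ => N x v * v) u < -α)
  (hdiff : ∀ x ∈ Ici x₀, Differentiable ℝ (N x))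

include hmono hdiff

lemma strictAnti_nonlinearity {x : ℝ} (hx : x ∈ Ici x₀) :
    StrictAnti fun v => N x v * v + α * v := by
  refine strictAnti_of_deriv_neg fun v => ?_
  have h1 : DifferentiableAt ℝ (fun v => N x v * v) v := (hdiff x hx v).mul differentiableAt_id
  have h2 := h1.hasDerivAt.add ((hasDerivAt_id v).const_mul α)
  have h3 : deriv (fun v => N x v * v + α * v) v = _ := h2.deriv
  rw [h3]
  linarith [hmono x hx v]

lemma nonlinearity_add_deriv_mul_lt {x : ℝ} (hx : x ∈ Ici x₀) (v : ℝ) :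
    N x v + deriv (N x) v * v < -α := by
  have h := (hdiff x hx v).hasDerivAt.mul (hasDerivAt_id v)
  have h2 : deriv (fun v => N x v * v) v = _ := h.deriv
  have := hmono x hx v
  rw [h2] at this
  simp only [id] at this
  linarith

/-- `(N + α) v` is strictly decreasing in `v` and vanishes at 0, so its sign is opposite to that of
`v`; at `v = 0` the derivative condition itself gives the bound. -/
lemma nonlinearity_le {x : ℝ} (hx : x ∈ Ici x₀) (v : ℝ) : N x v ≤ -α := by
  have hanti := strictAnti_nonlinearity hmono hdiff hx
  rcases lt_trichotomy v 0 with h | rfl | h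
  · have := hanti h
    simp only [mul_zero, add_zero] at this
    by_contra! hc
    nlinarith
  · have := nonlinearity_add_deriv_mul_lt hmono hdiff hx 0
    simp only [mul_zero, add_zero] at this
    exact this.le
  · have := hanti h
    simp only [mul_zero, add_zero] at this
    by_contra! hc
    nlinarith

/-- Monotonicity makes the squared distance of two solutions nonincreasing, and it starts at 0. -/
lemma IsCauchySolution.eqOn (hα : 0 < α) {u₀ : ℝ} {φ u v : ℝ → ℝ}
    (hu : IsCauchySolution x₀ u₀ N φ u) (hv : IsCauchySolution x₀ u₀ N φ v) :
    EqOn v u (Ici x₀) := by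
  have hd : ∀ x ∈ Ici x₀, HasDerivWithinAt (fun x => (v x - u x) ^ 2)
      (2 * (v x - u x) * ((N x (v x) * v x) - (N x (u x) * u x))) (Ici x₀) x := fun x hx =>
    (((hv.2 x hx).sub (hu.2 x hx)).pow 2).congr_deriv (by simp)
  have hanti : AntitoneOn (fun x => (v x - u x) ^ 2) (Ici x₀) := by
    refine antitoneOn_of_deriv_nonpos (convex_Ici x₀) (fun x hx => (hd x hx).continuousWithinAt)
      (fun x hx => ((hd x (interior_subset hx)).mono interior_subset).differentiableWithinAt)
      fun x hx => ?_
    have hx' := interior_subset hx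
    rw [interior_Ici] at hx
    rw [((hd x hx').hasDerivAt (Ici_mem_nhds hx)).deriv]
    have hs := strictAnti_nonlinearity hmono hdiff hx'
    rcases le_total (v x) (u x) with h | h
    · have h1 : N x (u x) * u x + α * u x ≤ N x (v x) * v x + α * v x := hs.antitone h
      have h2 := mul_nonneg hα.le (sub_nonneg.2 h)
      exact mul_nonpos_of_nonpos_of_nonneg (by linarith) (by linarith)
    · have h1 : N x (v x) * v x + α * v x ≤ N x (u x) * u x + α * u x := hs.antitone h
      have h2 := mul_nonneg hα.le (sub_nonneg.2 h)
      exact mul_nonpos_of_nonneg_of_nonpos (by linarith) (by linarith)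
  intro x hx
  have h := hanti self_mem_Ici hx hx
  simp only [hu.1, hv.1, sub_self] at h
  have h0 : (v x - u x) ^ 2 = 0 := le_antisymm (by simpa using h) (sq_nonneg _)
  exact sub_eq_zero.1 (pow_eq_zero_iff two_ne_zero |>.1 h0)

end Dissipative

/-! ### A priori bounds for the terms -/

/-- The standing assumptions on the right-hand side of the Cauchy problem. -/
structure Admissible (x₀ : ℝ) (N : ℝ → ℝ → ℝ) (φ : ℝ → ℝ) (a : ℕ → ℝ → ℝ) (B : ℕ → ℝ)
    (k α : ℝ) : Prop where
  continuousOn_coeff : ∀ i, ContinuousOn (a i) (Ici x₀)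
  hasSum : ∀ x ∈ Ici x₀, ∀ u : ℝ, HasSum (fun i : ℕ => a i x * u ^ i) (N x u)
  abs_le : ∀ i, ∀ x ∈ Ici x₀, |a i x| ≤ B i
  summable : ∀ u : ℝ, Summable fun i : ℕ => B i * u ^ i
  continuousOn_source : ContinuousOn φ (Ici x₀)
  source_le : ∀ x ∈ Ici x₀, |φ x| ≤ k
  pos : 0 < α
  deriv_lt : ∀ x ∈ Ici x₀, ∀ u : ℝ, deriv (fun v : ℝ => N x v * v) u < -α

/-- Constants for which the terms of the method satisfy `|U 0| ≤ M`, `|U j| ≤ δ * weight r j` and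
`|U j'| ≤ D * weight r j` on every grid of mesh at most `R * r`. -/
structure BoundConstants (u₀ : ℝ) (B : ℕ → ℝ) (k α M S D δ R : ℝ) : Prop where
  one_le_M : 1 ≤ M
  abs_le_M : |u₀| ≤ M
  lt_mul_M : k < α * M
  one_le_S : 1 ≤ S
  tsum_le_S : ∑' n, B n * (2 * (16 * (M + 1))) ^ n ≤ S
  le_D : S * (M + 1) + α + k ≤ D
  delta_pos : 0 < δ
  delta_le_one : δ ≤ 1
  R_pos : 0 < R
  rhs_le : 1024 * S * (M + 1) * (δ ^ 2 + D * R) ≤ α / 4 * δ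
  step_le_one : 2 * (S * (M + 1) + α) * R ≤ 1
  step_lt : 16 * (S * (M + 1) + α) ^ 2 * R < α
  step_le : 2 * S * D * R ≤ α

/-- The derivative of the `j`-th term of the method on a grid interval with left end point `xl`. -/
noncomputable def termDeriv (N : ℝ → ℝ → ℝ) (φ : ℝ → ℝ) (U : ℕ → ℝ → ℝ) (xl : ℝ) : ℕ → ℝ → ℝ
  | 0, x => N x (U 0 xl) * U 0 x + φ x
  | j + 1, x => N x (U 0 xl) * U (j + 1) x + deriv (N x) (U 0 xl) * U 0 x * U (j + 1) xl
      + rhsF N U xl j x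

/-- The bound for the `j`-th term of the method. -/
noncomputable def termBound (M δ r : ℝ) (j : ℕ) : ℝ := if j = 0 then M else δ * weight r j

lemma IsFDTerms.hasDerivWithinAt {x₀ u₀ : ℝ} {N : ℝ → ℝ → ℝ} {φ : ℝ → ℝ} {G : Grid x₀}
    {U : ℕ → ℝ → ℝ} (hU : IsFDTerms u₀ N φ G U) (j i : ℕ) :
    ∀ x ∈ Icc (G.node i) (G.node (i + 1)),
      HasDerivWithinAt (U j) (termDeriv N φ U (G.node i) j x)
        (Icc (G.node i) (G.node (i + 1))) x := by
  cases j with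
  | zero => exact hU.equation_zero i
  | succ j => exact hU.equation_succ j i

lemma Grid.abs_le_of_step {x₀ : ℝ} (G : Grid x₀) {y : ℝ → ℝ} {s : ℝ} (h0 : |y x₀| ≤ s)
    (hstep : ∀ i, |y (G.node i)| ≤ s → ∀ x ∈ Icc (G.node i) (G.node (i + 1)), |y x| ≤ s) :
    ∀ x ∈ Ici x₀, |y x| ≤ s := by
  have h : ∀ i, |y (G.node i)| ≤ s := by
    intro i
    induction i with
    | zero => rwa [G.node_zero]
    | succ i ih => exact hstep i ih _ (right_mem_Icc.2 (G.node_lt_succ i).le)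
  exact fun x hx => hstep _ (h _) x (Ico_subset_Icc_self (G.mem_index hx))

namespace Admissible

variable {x₀ : ℝ} {N : ℝ → ℝ → ℝ} {φ : ℝ → ℝ} {a : ℕ → ℝ → ℝ} {B : ℕ → ℝ} {k α : ℝ}
  (hA : Admissible x₀ N φ a B k α)

include hA

lemma hasDerivAt {x : ℝ} (hx : x ∈ Ici x₀) (u : ℝ) :
    HasDerivAt (N x) (∑' n : ℕ, a n x * (n * u ^ (n - 1))) u :=
  hasDerivAt_nonlinearity hA.hasSum hA.abs_le hA.summable hx u

lemma differentiable : ∀ x ∈ Ici x₀, Differentiable ℝ (N x) := fun _ hx u =>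
  (hA.hasDerivAt hx u).differentiableAt

lemma coeff_nonneg (n : ℕ) : 0 ≤ B n := (abs_nonneg _).trans (hA.abs_le n x₀ self_mem_Ici)

lemma source_nonneg : 0 ≤ k := (abs_nonneg _).trans (hA.source_le x₀ self_mem_Ici)

lemma adomian_eq {x : ℝ} (hx : x ∈ Ici x₀) (j : ℕ) (v : ℕ → ℝ) :
    adomian j (N x) v = PowerSeries.coeff j (compose (fun n => a n x) (PowerSeries.mk v)) :=
  adomian_nonlinearity hA.hasSum hA.abs_le hA.summable hx j v

variable {u₀ M S D δ R : ℝ}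

lemma abs_nonlinearity_le (hC : BoundConstants u₀ B k α M S D δ R) {x : ℝ} (hx : x ∈ Ici x₀)
    {u : ℝ} (hu : |u| ≤ M) : |N x u| ≤ S := by
  have h := abs_tsum_mul_le (fun n => hA.abs_le n x hx) hA.summable (p := fun n => u ^ n) (e := 1)
    (ρ := 2 * (16 * (M + 1))) fun n => by
      rw [abs_pow, one_mul]
      exact pow_le_pow_left₀ (abs_nonneg _) (by linarith [hC.one_le_M]) n
  rw [(hA.hasSum x hx u).tsum_eq, one_mul] at h
  exact h.trans hC.tsum_le_S

lemma abs_deriv_nonlinearity_le (hC : BoundConstants u₀ B k α M S D δ R) {x : ℝ}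
    (hx : x ∈ Ici x₀) {u : ℝ} (hu : |u| ≤ M) : |deriv (N x) u| ≤ S := by
  have hM := hC.one_le_M
  have h := abs_tsum_mul_le (fun n => hA.abs_le n x hx) hA.summable
    (p := fun n => n * u ^ (n - 1)) (abs_mul_pow_pred_le (c := 16 * (M + 1)) (by linarith)
      (by linarith))
  rw [← (hA.hasDerivAt hx u).deriv, one_mul] at h
  exact h.trans hC.tsum_le_S

-- Each part of `rhsF` is a coefficient of a product or composition of dominated series with a small
-- factor: `δ^2` in the first and third parts, the increment `R r D` across the step in the second.
-- The smallness of `δ` and of `R` relative to `δ` then gives `α / 4 * δ`.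
open PowerSeries in
lemma abs_rhsF_le (hC : BoundConstants u₀ B k α M S D δ R) {r : ℝ} (hr : 0 < r)
    {U : ℕ → ℝ → ℝ} {xl x : ℝ} (hx : x ∈ Ici x₀) {j : ℕ}
    (hb : ∀ i ≤ j, |U i x| ≤ termBound M δ r i) (hbl : ∀ i ≤ j, |U i xl| ≤ termBound M δ r i)
    (hd : ∀ i ≤ j, |U i x - U i xl| ≤ R * r * D * weight r i) :
    |rhsF N U xl j x| ≤ α / 4 * (δ * weight r (j + 1)) := by
  have hM := hC.one_le_M
  have hS := hC.one_le_S
  have hδ := hC.delta_pos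
  have hδ1 := hC.delta_le_one
  have hR := hC.R_pos
  have hD : 0 < D := by
    have := hC.le_D
    have := hA.pos
    have := hA.source_nonneg
    have : 0 < S * (M + 1) := by positivity
    linarith
  have hab := fun n => hA.abs_le n x hx
  set V := truncate j fun i => U i x with hV
  set W := truncate j fun i => U i xl with hW
  set σ := ∑' n, B n * (2 * (16 * (M + 1))) ^ n with hσ
  have hσS : σ ≤ S := hC.tsum_le_S
  have hσ0 : 0 ≤ σ := tsum_nonneg fun n => mul_nonneg (hA.coeff_nonneg n) (by positivity)
  have hw := weight_nonneg hr.le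
  have dom : ∀ y : ℝ, (∀ i ≤ j, |U i y| ≤ termBound M δ r i) →
      Dominated r (M + 1) (truncate j fun i => U i y) ∧
      Dominated r δ ((truncate j fun i => U i y) - C (U 0 y)) ∧ |U 0 y| ≤ M := by
    intro y hy
    refine ⟨fun i => ?_, fun i => ?_, by simpa [termBound] using hy 0 (Nat.zero_le j)⟩
    · rw [coeff_truncate]
      split_ifs with h
      · refine (hy i h).trans ?_
        unfold termBound
        split_ifs with h0
        · rw [h0, weight_zero]; linarith
        · exact mul_le_mul_of_nonneg_right (by linarith) (hw i)
      · rw [abs_zero]; exact mul_nonneg (by linarith) (hw i)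
    · rw [map_sub, coeff_truncate, coeff_C]
      rcases i with _ | i
      · simpa using mul_nonneg hδ.le (hw 0)
      · rw [if_neg (Nat.succ_ne_zero i), sub_zero]
        split_ifs with h
        · simpa [termBound] using hy (i + 1) h
        · rw [abs_zero]; exact mul_nonneg hδ.le (hw _)
  obtain ⟨hV1, hV2, hV3⟩ := dom x hb
  obtain ⟨hW1, hW2, hW3⟩ := dom xl hbl
  have hVW : Dominated r (R * r * D) (V - W) := fun i => by
    rw [map_sub, hV, hW, coeff_truncate, coeff_truncate]
    split_ifs with h
    · exact hd i h
    · simpa using mul_nonneg (by positivity) (hw i)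
  -- the three parts of the right-hand side
  have h1 : |∑ p ∈ Finset.Icc 1 j, adomian (j + 1 - p) (N x) (fun i => U i xl) * U p x| ≤
      256 * S * δ ^ 2 * weight r (j + 1) := by
    -- Both indices are at least 1 in this sum, so subtracting the constant terms changes nothing
    -- and makes both factors `O(δ)`.
    have e : ∑ p ∈ Finset.Icc 1 j, adomian (j + 1 - p) (N x) (fun i => U i xl) * U p x =
        coeff (j + 1) ((V - C (U 0 x)) *
          (compose (fun n => a n x) W - compose (fun n => a n x) (C (U 0 xl)))) := by
      have e1 : Finset.Icc 1 j = Finset.Ico 1 (j + 1) := by ext; simp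
      rw [e1, Finset.sum_Ico_eq_sum_range, coeff_mul,
        Finset.Nat.sum_antidiagonal_eq_sum_range_succ_mk, Finset.sum_range_succ,
        Finset.sum_range_succ']
      have e2 : coeff (j + 1) (V - C (U 0 x)) = 0 := by
        rw [map_sub, coeff_succ_C, hV, coeff_truncate, if_neg (by omega), sub_zero]
      have e3 : coeff 0 (V - C (U 0 x)) = 0 := by
        rw [map_sub, coeff_zero_C, hV, coeff_truncate, if_pos (Nat.zero_le j), sub_self]
      rw [e2, e3, zero_mul, zero_mul, add_zero, add_zero, Nat.add_sub_cancel]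
      refine Finset.sum_congr rfl fun i hi => ?_
      have hi := Finset.mem_range.1 hi
      obtain ⟨m, hm⟩ : ∃ m, j + 1 - (i + 1) = m + 1 := ⟨j - (i + 1), by omega⟩
      rw [add_comm 1 i, hm, map_sub, map_sub, coeff_succ_C, compose_C, coeff_succ_C, hV,
        coeff_truncate, if_pos (by omega), sub_zero, sub_zero, hA.adomian_eq hx, mul_comm, hW]
      congr 1
      exact coeff_compose_congr _ fun i hi => coeff_truncate_eq _ (by omega)
    rw [e]
    refine (hV2.mul hr.le hδ.le (dominated_compose_sub hab hA.summable hr.le (by linarith) hδ.le hW1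
      (Dominated.const hr.le (by linarith)) hW2) (j + 1)).trans ?_
    refine mul_le_mul_of_nonneg_right ?_ (hw _)
    calc 16 * δ * (16 * δ * σ) = 256 * σ * δ ^ 2 := by ring
      _ ≤ _ := by gcongr
  have h2 : |∑ p ∈ Finset.range (j + 1), (adomian (j - p) (N x) (fun i => U i x)
        - adomian (j - p) (N x) (fun i => U i xl)) * U p x| ≤
      1024 * S * (M + 1) * (D * R) * weight r (j + 1) := by
    have e : ∑ p ∈ Finset.range (j + 1), (adomian (j - p) (N x) (fun i => U i x)
        - adomian (j - p) (N x) (fun i => U i xl)) * U p x =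
        coeff j (V * (compose (fun n => a n x) V - compose (fun n => a n x) W)) := by
      rw [coeff_mul, Finset.Nat.sum_antidiagonal_eq_sum_range_succ_mk]
      refine Finset.sum_congr rfl fun p hp => ?_
      have hp := Finset.mem_range.1 hp
      rw [hA.adomian_eq hx, hA.adomian_eq hx, map_sub, mul_comm, hV, hW, coeff_truncate,
        if_pos (by omega)]
      congr 2
      · exact coeff_compose_congr _ fun i hi => coeff_truncate_eq _ (by omega)
      · exact coeff_compose_congr _ fun i hi => coeff_truncate_eq _ (by omega)
    rw [e]
    refine (hV1.mul hr.le (by linarith) (dominated_compose_sub hab hA.summable hr.le (by linarith)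
      (by positivity) hV1 hW1 hVW) j).trans ?_
    calc 16 * (M + 1) * (16 * (R * r * D) * σ) * weight r j
        = 256 * (M + 1) * R * D * σ * (r * weight r j) := by ring
      _ ≤ 256 * (M + 1) * R * D * S * (4 * weight r (j + 1)) := by
          have := hw j
          have := mul_weight_le hr.le j
          gcongr
      _ = _ := by ring
  have h3 : |adomian (j + 1) (N x) (fun i => if i ≤ j then U i xl else 0) * U 0 x| ≤
      256 * S * M * δ ^ 2 * weight r (j + 1) := by
    rw [hA.adomian_eq hx, abs_mul]
    -- The entry of index `j + 1` is set to 0 here, so the linear Taylor term drops out.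
    have h := abs_coeff_succ_compose_le hab hA.summable hr.le (by linarith) hδ.le hW1
      (by linarith : |U 0 xl| ≤ M + 1) hW2 j (by rw [coeff_truncate, if_neg (by omega)])
    calc _ ≤ ((16 * δ) ^ 2 * σ * weight r (j + 1)) * M :=
          mul_le_mul h hV3 (abs_nonneg _) (mul_nonneg (by positivity) (hw _))
      _ = 256 * σ * M * δ ^ 2 * weight r (j + 1) := by ring
      _ ≤ _ := by
          have := hw (j + 1)
          gcongr
  have h4 : |rhsF N U xl j x| ≤ 256 * S * δ ^ 2 * weight r (j + 1) +
      1024 * S * (M + 1) * (D * R) * weight r (j + 1) + 256 * S * M * δ ^ 2 * weight r (j + 1) := by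
    unfold rhsF
    exact (abs_add_le _ _).trans (add_le_add ((abs_add_le _ _).trans (add_le_add h1 h2)) h3)
  refine h4.trans ?_
  have h5 := mul_le_mul_of_nonneg_right hC.rhs_le (hw (j + 1))
  have h6 : 0 ≤ S * (M + 1) * δ ^ 2 * weight r (j + 1) :=
    mul_nonneg (by positivity) (hw _)
  linarith

/-- The basic estimate for the terms of the method and for their derivatives. -/
theorem abs_terms_le (hC : BoundConstants u₀ B k α M S D δ R) {r : ℝ} (hr : 0 < r) (hr1 : r ≤ 1)
    {G : Grid x₀} (hG : ∀ i, G.node (i + 1) - G.node i ≤ R * r) {U : ℕ → ℝ → ℝ}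
    (hU : IsFDTerms u₀ N φ G U) (j : ℕ) :
    (∀ x ∈ Ici x₀, |U j x| ≤ termBound M δ r j) ∧
      ∀ i, ∀ x ∈ Icc (G.node i) (G.node (i + 1)),
        |termDeriv N φ U (G.node i) j x| ≤ D * weight r j := by
  have hM := hC.one_le_M
  have hS := hC.one_le_S
  have hδ := hC.delta_pos
  have hδ1 := hC.delta_le_one
  have hR := hC.R_pos
  have hα := hA.pos
  have hk := hA.source_nonneg
  have hSM : 0 < S * M := by positivity
  have hleD := hC.le_D
  have hD : 0 < D := by linarith
  have hw := weight_pos hr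
  induction j using Nat.strong_induction_on with
  | _ j ih =>
  -- The derivative bound is part of the induction because it supplies these increments over a step
  -- of length at most `R r`.
  have osc : ∀ i < j, ∀ n, ∀ x ∈ Icc (G.node n) (G.node (n + 1)),
      |U i x - U i (G.node n)| ≤ R * r * D * weight r i := fun i hi n x hx => by
    have h := Convex.norm_image_sub_le_of_norm_hasDerivWithin_le (x := G.node n) (y := x)
      (hU.hasDerivWithinAt i n) (fun x hx => (ih i hi).2 n x hx) (convex_Icc _ _)
      (left_mem_Icc.2 (G.node_lt_succ n).le) hx
    rw [Real.norm_eq_abs, Real.norm_eq_abs, abs_of_nonneg (sub_nonneg.2 hx.1)] at h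
    have h2 : x - G.node n ≤ R * r := by linarith [hG n, hx.2]
    have h3 := mul_le_mul_of_nonneg_left h2 (mul_nonneg hD.le (hw i).le)
    linarith
  rcases j with _ | j
  · have hb : ∀ x ∈ Ici x₀, |U 0 x| ≤ M := by
      refine G.abs_le_of_step (by rw [hU.initial_zero]; exact hC.abs_le_M) fun i hi => ?_
      exact abs_le_of_dissipative (hU.equation_zero i) (by linarith)
        (fun x hx => nonlinearity_le hA.deriv_lt hA.differentiable (G.Icc_subset_Ici i hx) _)
        (fun x hx => (hA.source_le x (G.Icc_subset_Ici i hx)).trans_lt hC.lt_mul_M) hi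
    refine ⟨by simpa [termBound] using hb, fun i x hx => ?_⟩
    have hx' := G.Icc_subset_Ici i hx
    rw [weight_zero, mul_one, termDeriv]
    have h1 := hA.abs_nonlinearity_le hC hx' (hb _ (G.le_node i))
    have h2 : |N x (U 0 (G.node i)) * U 0 x| ≤ S * M := by
      rw [abs_mul]; exact mul_le_mul h1 (hb x hx') (abs_nonneg _) (by linarith)
    linarith [abs_add_le (N x (U 0 (G.node i)) * U 0 x) (φ x), hA.source_le x hx']
  · have hb0 : ∀ x ∈ Ici x₀, |U 0 x| ≤ M := by
      simpa [termBound] using (ih 0 (Nat.succ_pos j)).1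
    have hF : ∀ n, ∀ x ∈ Icc (G.node n) (G.node (n + 1)),
        |rhsF N U (G.node n) j x| ≤ α / 4 * (δ * weight r (j + 1)) := fun n x hx =>
      hA.abs_rhsF_le hC hr (G.Icc_subset_Ici n hx)
        (fun i hi => (ih i (by omega)).1 x (G.Icc_subset_Ici n hx))
        (fun i hi => (ih i (by omega)).1 _ (G.le_node n))
        (fun i hi => osc i (by omega) n x hx)
    have hs : 0 < δ * weight r (j + 1) := mul_pos hδ (hw _)
    have hcoef : ∀ n, ∀ x ∈ Icc (G.node n) (G.node (n + 1)),
        |N x (U 0 (G.node n))| ≤ S ∧ |deriv (N x) (U 0 (G.node n)) * U 0 x| ≤ S * M :=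
      fun n x hx => by
        have hx' := G.Icc_subset_Ici n hx
        refine ⟨hA.abs_nonlinearity_le hC hx' (hb0 _ (G.le_node n)), ?_⟩
        rw [abs_mul]
        exact mul_le_mul (hA.abs_deriv_nonlinearity_le hC hx' (hb0 _ (G.le_node n))) (hb0 x hx')
          (abs_nonneg _) (by linarith)
    have hb : ∀ x ∈ Ici x₀, |U (j + 1) x| ≤ δ * weight r (j + 1) := by
      refine G.abs_le_of_step (by rw [hU.initial_succ, abs_zero]; exact hs.le) fun n hn => ?_
      have hRr : R * r ≤ R := mul_le_of_le_one_right hR.le hr1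
      have hstep : G.node (n + 1) - G.node n ≤ R := (hG n).trans hRr
      refine abs_le_of_frozen (α := α) (P := S * (M + 1) + α) (hU.equation_succ j n) hs hα
        (by nlinarith)
        (fun x hx => (nonlinearity_le hA.deriv_lt hA.differentiable
          (G.Icc_subset_Ici n hx) _).trans (by linarith))
        (fun x hx => (hcoef n x hx).1.trans (by linarith))
        (fun x hx => (hcoef n x hx).2.trans (by linarith)) (fun x hx => ?_) (hF n)
        (G.node_lt_succ n).le ?_ ?_ hn
      -- At the node itself the sum of coefficients is below `-α`; replacing `U 0` at the node by `U
      -- 0 x` costs at most `S R D ≤ α / 2`.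
      · have hx' := G.Icc_subset_Ici n hx
        have h1 := nonlinearity_add_deriv_mul_lt hA.deriv_lt hA.differentiable hx'
          (U 0 (G.node n))
        have h2 := osc 0 (Nat.succ_pos j) n x hx
        rw [weight_zero, mul_one] at h2
        have h3 : |deriv (N x) (U 0 (G.node n)) * (U 0 x - U 0 (G.node n))| ≤ S * (R * D) := by
          rw [abs_mul]
          refine mul_le_mul (hA.abs_deriv_nonlinearity_le hC hx' (hb0 _ (G.le_node n)))
            (h2.trans ?_) (abs_nonneg _) (by linarith)
          exact mul_le_mul_of_nonneg_right hRr hD.le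
        have h4 := le_of_abs_le h3
        have h5 := hC.step_le
        linarith
      · exact (mul_le_mul_of_nonneg_left hstep (by linarith)).trans hC.step_le_one
      · exact (mul_le_mul_of_nonneg_left hstep (by positivity)).trans_lt hC.step_lt
    refine ⟨by simpa [termBound] using hb, fun n x hx => ?_⟩
    have hx' := G.Icc_subset_Ici n hx
    obtain ⟨h1, h2⟩ := hcoef n x hx
    have hle : δ * weight r (j + 1) ≤ weight r (j + 1) := mul_le_of_le_one_left (hw _).le hδ1
    have h3 : |N x (U 0 (G.node n)) * U (j + 1) x| ≤ S * weight r (j + 1) := by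
      rw [abs_mul]
      exact mul_le_mul h1 ((hb x hx').trans hle) (abs_nonneg _) (by linarith)
    have h4 : |deriv (N x) (U 0 (G.node n)) * U 0 x * U (j + 1) (G.node n)| ≤
        S * M * weight r (j + 1) := by
      rw [abs_mul]
      exact mul_le_mul h2 ((hb _ (G.le_node n)).trans hle) (abs_nonneg _) hSM.le
    have h5 : |rhsF N U (G.node n) j x| ≤ α * weight r (j + 1) :=
      (hF n x hx).trans (by nlinarith [hw (j + 1)])
    have h6 := mul_le_mul_of_nonneg_right hleD (hw (j + 1)).le
    have h7 : 0 ≤ k * weight r (j + 1) := mul_nonneg hk (hw _).le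
    rw [termDeriv]
    linarith [abs_add_le (N x (U 0 (G.node n)) * U (j + 1) x
      + deriv (N x) (U 0 (G.node n)) * U 0 x * U (j + 1) (G.node n)) (rhsF N U (G.node n) j x),
      abs_add_le (N x (U 0 (G.node n)) * U (j + 1) x)
        (deriv (N x) (U 0 (G.node n)) * U 0 x * U (j + 1) (G.node n))]

-- The order of choice matters: `M`, `S`, `D` come from the data, then `δ` beats the quadratic
-- terms, and `R` is taken last since it must be small relative to `δ`.
omit hA in
lemma exists_boundConstants (B : ℕ → ℝ) (u₀ k : ℝ) {α : ℝ} (hα : 0 < α) :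
    ∃ M S D δ R, BoundConstants u₀ B k α M S D δ R := by
  set M := max |u₀| (|k| / α) + 1 with hM
  have hM0 : 0 ≤ max |u₀| (|k| / α) := (abs_nonneg _).trans (le_max_left _ _)
  set S := |∑' n, B n * (2 * (16 * (M + 1))) ^ n| + 1 with hS
  have hS1 : 1 ≤ S := le_add_of_nonneg_left (abs_nonneg _)
  have hM1 : 1 ≤ M := le_add_of_nonneg_left hM0
  set P := S * (M + 1) + α with hP
  have hP0 : 0 < P := by positivity
  set D := P + |k| with hD
  have hD0 : 0 < D := add_pos_of_pos_of_nonneg hP0 (abs_nonneg k)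
  set Q := 1024 * S * (M + 1) with hQ
  have hQ0 : 0 < Q := by positivity
  obtain ⟨δ, hδ0, hδ1, hδ⟩ : ∃ δ : ℝ, 0 < δ ∧ δ ≤ 1 ∧ Q * δ ≤ α / 8 := by
    refine ⟨min 1 (α / 8 / Q), by positivity, min_le_left _ _, ?_⟩
    rw [mul_comm, ← le_div_iff₀ hQ0]
    exact min_le_right _ _
  -- `R` is the reciprocal of a sum with one summand for each smallness condition.
  obtain ⟨R, hR0, hR⟩ : ∃ R : ℝ, 0 < R ∧
      R * (Q * D / (α / 8 * δ) + 2 * P + 32 * P ^ 2 / α + 2 * S * D / α) ≤ 1 := by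
    refine ⟨(Q * D / (α / 8 * δ) + 2 * P + 32 * P ^ 2 / α + 2 * S * D / α)⁻¹, by positivity, ?_⟩
    rw [inv_mul_cancel₀ (by positivity)]
  have t1 : 0 ≤ R * (Q * D / (α / 8 * δ)) := by positivity
  have t2 : 0 ≤ R * (2 * P) := by positivity
  have t3 : 0 ≤ R * (32 * P ^ 2 / α) := by positivity
  have t4 : 0 ≤ R * (2 * S * D / α) := by positivity
  simp only [mul_add] at hR
  have r1 : R * (Q * D) ≤ α / 8 * δ := by
    have : R * (Q * D / (α / 8 * δ)) ≤ 1 := by linarith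
    rwa [← mul_div_assoc, div_le_one (by positivity)] at this
  have r2 : R * (32 * P ^ 2) ≤ α := by
    have : R * (32 * P ^ 2 / α) ≤ 1 := by linarith
    rwa [← mul_div_assoc, div_le_one hα] at this
  have r3 : R * (2 * S * D) ≤ α := by
    have : R * (2 * S * D / α) ≤ 1 := by linarith
    rwa [← mul_div_assoc, div_le_one hα] at this
  have r4 : 0 < R * P ^ 2 := by positivity
  exact ⟨M, S, D, δ, R,
    { one_le_M := hM1
      abs_le_M := by linarith [le_max_left |u₀| (|k| / α)]
      lt_mul_M := by
        have h1 : |k| / α < M := by linarith [le_max_right |u₀| (|k| / α)]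
        rw [div_lt_iff₀ hα, mul_comm] at h1
        exact (le_abs_self k).trans_lt h1
      one_le_S := hS1
      tsum_le_S := by linarith [le_abs_self (∑' n, B n * (2 * (16 * (M + 1))) ^ n)]
      le_D := by linarith [le_abs_self k]
      delta_pos := hδ0
      delta_le_one := hδ1
      R_pos := hR0
      rhs_le := by nlinarith
      step_le_one := by linarith
      step_lt := by linarith
      step_le := by linarith }⟩

end Admissible

/-! ### Summation of the series -/

lemma Grid.exists_mem_Ioc {x₀ : ℝ} (G : Grid x₀) {x : ℝ} (hx : x₀ < x) :
    ∃ i, x ∈ Ioc (G.node i) (G.node (i + 1)) := by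
  have h := G.mem_index hx.le
  rcases h.1.lt_or_eq with h1 | h1
  · exact ⟨_, h1, h.2.le⟩
  · rcases hi : G.index x with _ | i
    · rw [hi, G.node_zero] at h1
      exact absurd h1 hx.ne
    · rw [hi] at h1
      exact ⟨i, h1 ▸ G.node_lt_succ i, h1.ge⟩

/-- A continuous function that is differentiable off the grid points, with a derivative that
extends continuously, is differentiable. -/
lemma Grid.hasDerivWithinAt_Ici {x₀ : ℝ} (G : Grid x₀) {w g : ℝ → ℝ}
    (hw : ContinuousOn w (Ici x₀)) (hg : ContinuousOn g (Ici x₀))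
    (hd : ∀ i, ∀ x ∈ Ioo (G.node i) (G.node (i + 1)), HasDerivAt w (g x) x) :
    ∀ x ∈ Ici x₀, HasDerivWithinAt w (g x) (Ici x₀) x := by
  have right : ∀ x ∈ Ici x₀, HasDerivWithinAt w (g x) (Ici x) x := fun x hx => by
    have hi := G.mem_index hx
    have hmem : Ioo x (G.node (G.index x + 1)) ∈ 𝓝[>] x := Ioo_mem_nhdsGT hi.2
    have hd' : ∀ y ∈ Ioo x (G.node (G.index x + 1)), HasDerivAt w (g y) y := fun y hy =>
      hd _ y ⟨hi.1.trans_lt hy.1, hy.2⟩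
    refine hasDerivWithinAt_Ici_of_tendsto_deriv
      (fun y hy => (hd' y hy).differentiableAt.differentiableWithinAt)
      ((hw x hx).mono fun y hy => le_trans hx hy.1.le) hmem ?_
    have ht : Tendsto g (𝓝[>] x) (𝓝 (g x)) :=
      (hg x hx).mono_left (nhdsWithin_mono x fun y hy => le_trans (mem_Ici.1 hx) (le_of_lt hy))
    refine ht.congr' ?_
    filter_upwards [hmem] with y hy using (hd' y hy).deriv.symm
  have left : ∀ x, x₀ < x → HasDerivWithinAt w (g x) (Iic x) x := fun x hx => by
    obtain ⟨i, hi⟩ := G.exists_mem_Ioc hx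
    have hmem : Ioo (G.node i) x ∈ 𝓝[<] x := Ioo_mem_nhdsLT hi.1
    have hd' : ∀ y ∈ Ioo (G.node i) x, HasDerivAt w (g y) y := fun y hy =>
      hd _ y ⟨hy.1, hy.2.trans_le hi.2⟩
    refine hasDerivWithinAt_Iic_of_tendsto_deriv
      (fun y hy => (hd' y hy).differentiableAt.differentiableWithinAt)
      ((hw x hx.le).mono fun y hy => (G.le_node i).trans hy.1.le) hmem ?_
    have ht : Tendsto g (𝓝[<] x) (𝓝 (g x)) := by
      refine ((hg x hx.le).continuousAt (Ici_mem_nhds hx)).tendsto.mono_left nhdsWithin_le_nhds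
    refine ht.congr' ?_
    filter_upwards [hmem] with y hy using (hd' y hy).deriv.symm
  intro x hx
  rcases (mem_Ici.1 hx).lt_or_eq with h | h
  · have := (left x h).union (right x hx)
    rw [Iic_union_Ici] at this
    exact this.mono (subset_univ _)
  · have := right x hx
    rwa [← h] at this ⊢

namespace Admissible

variable {x₀ : ℝ} {N : ℝ → ℝ → ℝ} {φ : ℝ → ℝ} {a : ℕ → ℝ → ℝ} {B : ℕ → ℝ} {k α : ℝ}
  (hA : Admissible x₀ N φ a B k α) {u₀ M S D δ R : ℝ}

lemma termBound_le (hC : BoundConstants u₀ B k α M S D δ R) {r : ℝ} (hr : 0 ≤ r) (j : ℕ) :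
    termBound M δ r j ≤ (M + 1) * weight r j := by
  have hM := hC.one_le_M
  have hδ := hC.delta_le_one
  unfold termBound
  split_ifs with h
  · rw [h, weight_zero]; linarith
  · exact mul_le_mul_of_nonneg_right (by linarith) (weight_nonneg hr j)

include hA

-- This is the degree `j + 1` part of `V' = V N(W) + t V (N(V) - N(W)) + φ`. The term `N' U 0 x U (j
-- + 1) xl` of the scheme is what `rhsF` omits from the Adomian polynomial of degree `j + 1`.
open PowerSeries in
lemma termDeriv_succ {U : ℕ → ℝ → ℝ} {xl x : ℝ} (hx : x ∈ Ici x₀) (j : ℕ) :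
    termDeriv N φ U xl (j + 1) x =
      coeff (j + 1) (PowerSeries.mk (fun i => U i x) *
        compose (fun n => a n x) (PowerSeries.mk fun i => U i xl)) +
      coeff j (PowerSeries.mk (fun i => U i x) *
        (compose (fun n => a n x) (PowerSeries.mk fun i => U i x) -
          compose (fun n => a n x) (PowerSeries.mk fun i => U i xl))) := by
  have hz : coeff 0 (compose (fun n => a n x) (PowerSeries.mk fun i => U i xl)) =
      N x (U 0 xl) := by
    rw [coeff_compose, ← (hA.hasSum x hx (U 0 xl)).tsum_eq]
    simp
  have h1 := coeff_succ_compose (fun n => hA.abs_le n x hx) hA.summable (fun i => U i xl) j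
  rw [← (hA.hasDerivAt hx _).deriv] at h1
  have e0 : coeff (j + 1) (PowerSeries.mk (fun i => U i x) *
        compose (fun n => a n x) (PowerSeries.mk fun i => U i xl)) =
      (∑ i ∈ Finset.range j, U (i + 1) x * coeff (j + 1 - (i + 1))
        (compose (fun n => a n x) (PowerSeries.mk fun i => U i xl))) +
      U 0 x * (coeff (j + 1) (compose (fun n => a n x) (truncate j fun i => U i xl)) +
        deriv (N x) (U 0 xl) * U (j + 1) xl) + U (j + 1) x * N x (U 0 xl) := by
    rw [coeff_mul, Finset.Nat.sum_antidiagonal_eq_sum_range_succ_mk, Finset.sum_range_succ,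
      Finset.sum_range_succ']
    simp only [Nat.sub_self, Nat.sub_zero, coeff_mk, hz, h1]
  have e1 : Finset.Icc 1 j = Finset.Ico 1 (j + 1) := by ext; simp
  rw [termDeriv, rhsF, e0, coeff_mul, Finset.Nat.sum_antidiagonal_eq_sum_range_succ_mk, e1,
    Finset.sum_Ico_eq_sum_range, hA.adomian_eq hx (j + 1)]
  simp only [Nat.add_sub_cancel, coeff_mk, map_sub]
  have e2 : ∀ i ∈ Finset.range j, adomian (j + 1 - (1 + i)) (N x) (fun i => U i xl) * U (1 + i) x =
      U (i + 1) x * coeff (j + 1 - (i + 1))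
        (compose (fun n => a n x) (PowerSeries.mk fun i => U i xl)) := fun i _ => by
    rw [hA.adomian_eq hx, add_comm 1 i, mul_comm]
  have e3 : ∀ p ∈ Finset.range (j + 1), (adomian (j - p) (N x) (fun i => U i x)
      - adomian (j - p) (N x) (fun i => U i xl)) * U p x = U p x *
      (coeff (j - p) (compose (fun n => a n x) (PowerSeries.mk fun i => U i x)) -
        coeff (j - p) (compose (fun n => a n x) (PowerSeries.mk fun i => U i xl))) := fun p _ => by
    rw [hA.adomian_eq hx, hA.adomian_eq hx, mul_comm]
  rw [Finset.sum_congr rfl e2, Finset.sum_congr rfl e3]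
  have e4 : (PowerSeries.mk fun i => if i ≤ j then U i xl else 0) =
    truncate j fun i => U i xl := rfl
  rw [e4]
  ring

open PowerSeries in
lemma hasSum_termDeriv (hC : BoundConstants u₀ B k α M S D δ R) {r : ℝ} (hr : 0 ≤ r) (hr1 : r ≤ 1)
    {U : ℕ → ℝ → ℝ} {xl x : ℝ} (hx : x ∈ Ici x₀) (hb : ∀ i, |U i x| ≤ termBound M δ r i)
    (hbl : ∀ i, |U i xl| ≤ termBound M δ r i) :
    HasSum (fun j => termDeriv N φ U xl j x)
      (N x (∑' j, U j x) * (∑' j, U j x) + φ x) := by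
  have hM := hC.one_le_M
  have hab := fun n => hA.abs_le n x hx
  have hc : 0 ≤ M + 1 := by linarith
  have dom : ∀ y, (∀ i, |U i y| ≤ termBound M δ r i) →
      Dominated r (M + 1) (PowerSeries.mk fun i => U i y) := fun y hy i => by
    rw [coeff_mk]
    exact (hy i).trans (termBound_le hC hr i)
  have hV := dom x hb
  have hL := dom xl hbl
  have hcV := dominated_compose hab hA.summable hr hc hV
  have hcL := dominated_compose hab hA.summable hr hc hL
  have s1 := hV.hasSum_mul hr hr1 hc hcL
  have s2 := hV.hasSum_mul hr hr1 hc (hcV.sub hcL)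
  have sV := hasSum_compose hab hA.summable hr hr1 hc hV
  have sL := hasSum_compose hab hA.summable hr hr1 hc hL
  have sVL := sV.sub sL
  simp only [← map_sub] at sVL
  rw [sL.tsum_eq] at s1
  rw [sVL.tsum_eq] at s2
  rw [(hA.hasSum x hx _).tsum_eq] at s1 s2
  rw [(hA.hasSum x hx _).tsum_eq] at s2
  have hz : coeff 0 (PowerSeries.mk (fun i => U i x) *
      compose (fun n => a n x) (PowerSeries.mk fun i => U i xl)) = U 0 x * N x (U 0 xl) := by
    have h0 : coeff 0 (compose (fun n => a n x) (PowerSeries.mk fun i => U i xl)) =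
        N x (U 0 xl) := by
      rw [coeff_compose, ← (hA.hasSum x hx (U 0 xl)).tsum_eq]
      simp
    rw [coeff_mul, Finset.Nat.antidiagonal_zero, Finset.sum_singleton, h0, coeff_mk]
  -- Degree 0 is split off, since the formula for the derivatives covers only positive degrees; it
  -- returns together with `φ` in `s4`.
  have s3 := ((hasSum_nat_add_iff' 1).2 s1).add s2
  rw [Finset.sum_range_one, hz] at s3
  simp only [← hA.termDeriv_succ (φ := φ) (U := U) (xl := xl) hx] at s3
  have s4 := (hasSum_nat_add_iff (f := fun j => termDeriv N φ U xl j x) 1).1 s3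
  rw [Finset.sum_range_one, termDeriv] at s4
  simp only [coeff_mk] at s4
  -- The contributions of the frozen values cancel here.
  have e : N x (∑' j, U j x) * (∑' j, U j x) + φ x =
      (∑' i, U i x) * N x (∑' i, U i xl) - U 0 x * N x (U 0 xl) +
        (∑' i, U i x) * (N x (∑' i, U i x) - N x (∑' i, U i xl)) +
      (N x (U 0 xl) * U 0 x + φ x) := by ring
  rw [e]
  exact s4

section Convergence

variable (hC : BoundConstants u₀ B k α M S D δ R) {r : ℝ} (hr : 0 < r) (hr1 : r ≤ 1)
    {G : Grid x₀} (hG : ∀ i, G.node (i + 1) - G.node i ≤ R * r) {U : ℕ → ℝ → ℝ}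
    (hU : IsFDTerms u₀ N φ G U)

include hC hr hr1 hG hU

lemma abs_term_le (j : ℕ) {x : ℝ} (hx : x ∈ Ici x₀) : |U j x| ≤ (M + 1) * weight r j :=
  ((hA.abs_terms_le hC hr hr1 hG hU j).1 x hx).trans (termBound_le hC hr.le j)

lemma summable_terms {x : ℝ} (hx : x ∈ Ici x₀) : Summable fun j => U j x :=
  Summable.of_norm_bounded ((summable_weight hr.le hr1).mul_left (M + 1)) fun j =>
    hA.abs_term_le hC hr hr1 hG hU j hx

/-- The sum of the terms of the method solves the Cauchy problem. -/
theorem isCauchySolution_tsum : IsCauchySolution x₀ u₀ N φ fun x => ∑' j, U j x := by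
  have hsum := summable_weight hr.le hr1
  have hb := fun j => (hA.abs_terms_le hC hr hr1 hG hU j).1
  have hcont : ContinuousOn (fun x => ∑' j, U j x) (Ici x₀) :=
    continuousOn_tsum hU.continuousOn (hsum.mul_left (M + 1)) fun j x hx =>
      hA.abs_term_le hC hr hr1 hG hU j hx
  have hbd : ∀ x ∈ Ici x₀, |∑' j, U j x| ≤ ∑' j, (M + 1) * weight r j := fun x hx =>
    tsum_of_norm_bounded (f := fun j => U j x) (hsum.mul_left (M + 1)).hasSum fun j =>
      hA.abs_term_le hC hr hr1 hG hU j hx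
  refine ⟨?_, G.hasDerivWithinAt_Ici hcont
    (((continuousOn_nonlinearity hA.continuousOn_coeff hA.hasSum hA.abs_le hA.summable
      subset_rfl hcont hbd).mul hcont).add hA.continuousOn_source) fun i x hx => ?_⟩
  · dsimp only
    rw [tsum_eq_single 0, hU.initial_zero]
    intro j hj
    obtain ⟨j, rfl⟩ := Nat.exists_eq_succ_of_ne_zero hj
    exact hU.initial_succ j
  · have hx' := G.Icc_subset_Ici i (Ioo_subset_Icc_self hx)
    rw [← (hA.hasSum_termDeriv hC hr.le hr1 hx' (fun j => hb j x hx')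
      fun j => hb j _ (G.le_node i)).tsum_eq]
    refine hasDerivAt_tsum_of_isPreconnected (hsum.mul_left D) isOpen_Ioo isPreconnected_Ioo
      (g' := fun j x => termDeriv N φ U (G.node i) j x)
      (fun j y hy => (hU.hasDerivWithinAt j i y (Ioo_subset_Icc_self hy)).hasDerivAt
        (Icc_mem_nhds hy.1 hy.2))
      (fun j y hy => (hA.abs_terms_le hC hr hr1 hG hU j).2 i y (Ioo_subset_Icc_self hy)) hx
      (hA.summable_terms hC hr hr1 hG hU hx') hx

theorem tendstoUniformlyOn_partialSum :
    TendstoUniformlyOn (partialSum U) (fun x => ∑' j, U j x) atTop (Ici x₀) := by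
  have h := tendstoUniformlyOn_tsum_nat (f := U) ((summable_weight hr.le hr1).mul_left (M + 1))
    (s := Ici x₀) fun j x hx => hA.abs_term_le hC hr hr1 hG hU j hx
  -- The `m`-th partial sum has `m + 1` terms, hence the shift.
  exact fun V hV => (tendsto_add_atTop_nat 1).eventually (h V hV)

theorem abs_sub_partialSum_le (m : ℕ) {x : ℝ} (hx : x ∈ Ici x₀) :
    |(∑' j, U j x) - partialSum U m x| ≤ δ * ∑' j, weight r (j + (m + 1)) := by
  have hs := hA.summable_terms hC hr hr1 hG hU hx
  have e : (∑' j, U j x) - partialSum U m x = ∑' j, U (j + (m + 1)) x := by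
    rw [partialSum, ← hs.sum_add_tsum_nat_add (m + 1), add_sub_cancel_left]
  rw [e, ← tsum_mul_left]
  refine tsum_of_norm_bounded (f := fun j => U (j + (m + 1)) x)
    (((summable_nat_add_iff (m + 1)).2 (summable_weight hr.le hr1)).mul_left δ).hasSum fun j => ?_
  simpa [termBound] using (hA.abs_terms_le hC hr hr1 hG hU (j + (m + 1))).1 x hx

end Convergence

end Admissible

/-! ### Error estimates and conclusion -/

lemma tsum_weight_tail_le {r : ℝ} (hr : 0 ≤ r) (hr1 : r < 1) (m : ℕ) :
    ∑' j, weight r (j + (m + 1)) ≤ 1 / (1 + (m : ℝ)) ^ 2 * (r ^ (m + 1) / (1 - r)) := by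
  -- All denominators in the tail are replaced by the smaller `(1 + m)^2`; a geometric series
  -- remains.
  have hg := (hasSum_geometric_of_lt_one hr hr1).mul_left
    (1 / (1 + (m : ℝ)) ^ 2 * r ^ (m + 1))
  rw [div_eq_mul_inv (r ^ (m + 1)), ← mul_assoc, ← hg.tsum_eq]
  refine Summable.tsum_le_tsum (fun j => ?_)
    ((summable_nat_add_iff (m + 1)).2 (summable_weight hr hr1.le)) hg.summable
  calc weight r (j + (m + 1)) = r ^ (m + 1) * r ^ j * (1 / (((j + (m + 1) : ℕ) : ℝ) + 1) ^ 2) := by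
        unfold weight; ring
    _ ≤ r ^ (m + 1) * r ^ j * (1 / (1 + (m : ℝ)) ^ 2) := by
        gcongr ?_ * (1 / ?_ ^ 2)
        push_cast
        linarith [(Nat.cast_nonneg j : (0 : ℝ) ≤ j)]
    _ = _ := by ring

lemma Grid.HasMesh.pos {x₀ h : ℝ} {G : Grid x₀} (hG : G.HasMesh h) : 0 < h :=
  (sub_pos.2 (G.node_lt_succ 0)).trans_le (hG.1 ⟨0, rfl⟩)

/-- The uniform grid of step `R`. -/
noncomputable def uniformGrid (x₀ : ℝ) {R : ℝ} (hR : 0 < R) : Grid x₀ where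
  node i := x₀ + i * R
  node_zero := by simp
  node_strictMono i j hij := by
    have : (i : ℝ) < j := by exact_mod_cast hij
    simpa using mul_lt_mul_of_pos_right this hR
  node_tendsto := tendsto_atTop_add_const_left _ _
    (tendsto_natCast_atTop_atTop.atTop_mul_const hR)

end FDMethod

theorem theorem1
    (x₀ u₀ : ℝ) (N : ℝ → ℝ → ℝ) (φ : ℝ → ℝ) (a : ℕ → ℝ → ℝ) (B : ℕ → ℝ) (k α : ℝ)
    (ha_cont : ∀ i, ContinuousOn (a i) (Set.Ici x₀))
    (hN : ∀ x ∈ Set.Ici x₀, ∀ u : ℝ, HasSum (fun i : ℕ => a i x * u ^ i) (N x u))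
    (haB : ∀ i, ∀ x ∈ Set.Ici x₀, |a i x| ≤ B i)
    (hB : ∀ u : ℝ, Summable fun i : ℕ => B i * u ^ i)
    (hφ_cont : ContinuousOn φ (Set.Ici x₀))
    (hφ_bdd : ∀ x ∈ Set.Ici x₀, |φ x| ≤ k)
    (hα : 0 < α)
    (hmono : ∀ x ∈ Set.Ici x₀, ∀ u : ℝ, deriv (fun v : ℝ => N x v * v) u < -α) :
    -- the terms of the method exist on every grid
    (∀ G : FDMethod.Grid x₀, ∃ U : ℕ → ℝ → ℝ, FDMethod.IsFDTerms u₀ N φ G U) ∧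
    -- the solution exists on the whole half-line (and is unique), and the method converges to it
    ∃ u : ℝ → ℝ, FDMethod.IsCauchySolution x₀ u₀ N φ u ∧
      (∀ v : ℝ → ℝ, FDMethod.IsCauchySolution x₀ u₀ N φ v → Set.EqOn v u (Set.Ici x₀)) ∧
      FDMethod.FDConvergesTo x₀ u₀ N φ u ∧
      -- error estimates, with constants that do not depend on the grid
      ∃ C R ε : ℝ, 0 < C ∧ 0 < R ∧ 0 < ε ∧
        ∀ (G : FDMethod.Grid x₀) (h : ℝ), G.HasMesh h →
          ∀ U : ℕ → ℝ → ℝ, FDMethod.IsFDTerms u₀ N φ G U → ∀ m : ℕ,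
            (h < R → ∀ x ∈ Set.Ici x₀,
              |u x - FDMethod.partialSum U m x| ≤
                C / (1 + (m : ℝ)) ^ (1 + ε) * ((h / R) ^ (m + 1) / (1 - h / R))) ∧
            (h = R → ∀ x ∈ Set.Ici x₀,
              |u x - FDMethod.partialSum U m x| ≤
                C * ∑' j : ℕ, 1 / (((m + 1 + j : ℕ) : ℝ) + 1) ^ (1 + ε)) := by
  have hA : FDMethod.Admissible x₀ N φ a B k α :=
    ⟨ha_cont, hN, haB, hB, hφ_cont, hφ_bdd, hα, hmono⟩
  have hex : ∀ G : FDMethod.Grid x₀, ∃ U : ℕ → ℝ → ℝ, FDMethod.IsFDTerms u₀ N φ G U := fun G =>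
    FDMethod.exists_isFDTerms ha_cont hN haB hB u₀ hφ_cont G
  obtain ⟨M, S, D, δ, R, hC⟩ := FDMethod.Admissible.exists_boundConstants B u₀ k hα
  have hR := hC.R_pos
  -- The method itself constructs the solution: the uniform grid of step `R` corresponds to `r = 1`,
  -- where the weights are still summable.
  obtain ⟨U₁, hU₁⟩ := hex (FDMethod.uniformGrid x₀ hR)
  have hsol := hA.isCauchySolution_tsum hC one_pos le_rfl
    (G := FDMethod.uniformGrid x₀ hR) (fun i => by simp [FDMethod.uniformGrid]; linarith) hU₁
  have huniq : ∀ v, FDMethod.IsCauchySolution x₀ u₀ N φ v →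
      Set.EqOn v (fun x => ∑' j, U₁ j x) (Set.Ici x₀) := fun v hv =>
    FDMethod.IsCauchySolution.eqOn hmono hA.differentiable hα hsol hv
  have hstep : ∀ (G : FDMethod.Grid x₀) (h : ℝ), G.HasMesh h →
      ∀ i, G.node (i + 1) - G.node i ≤ R * (h / R) := fun G h hG i => by
    rw [mul_div_cancel₀ _ hR.ne']
    exact hG.1 ⟨i, rfl⟩
  -- The same `R` is the mesh threshold and the radius in the estimates; `C = δ`, and `ε = 1`
  -- reflects the square in the weights.
  refine ⟨hex, _, hsol, huniq, ⟨R, hR, fun G h hG hh U hU => ?_⟩, δ, R, 1, hC.delta_pos, hR,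
    one_pos, fun G h hG U hU m => ?_⟩
  · have hr : 0 < h / R := div_pos hG.pos hR
    have hr1 : h / R ≤ 1 := (div_le_one hR).2 hh
    exact (hA.tendstoUniformlyOn_partialSum hC hr hr1 (hstep G h hG) hU).congr_right
      (huniq _ (hA.isCauchySolution_tsum hC hr hr1 (hstep G h hG) hU))
  · have hr : 0 < h / R := div_pos hG.pos hR
    have main : h / R ≤ 1 → ∀ x ∈ Set.Ici x₀, |(∑' j, U₁ j x) - FDMethod.partialSum U m x| ≤
        δ * ∑' j, FDMethod.weight (h / R) (j + (m + 1)) := fun hr1 x hx => by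
      have e : ∑' j, U j x = ∑' j, U₁ j x :=
        huniq _ (hA.isCauchySolution_tsum hC hr hr1 (hstep G h hG) hU) hx
      rw [← e]
      exact hA.abs_sub_partialSum_le hC hr hr1 (hstep G h hG) hU m hx
    have h2 : (1 : ℝ) + 1 = (2 : ℕ) := by norm_num
    refine ⟨fun hlt x hx => ?_, fun heq x hx => ?_⟩
    · have hr1 : h / R < 1 := (div_lt_one hR).2 hlt
      refine (main hr1.le x hx).trans ?_
      rw [h2, Real.rpow_natCast, div_eq_mul_one_div δ, mul_assoc]
      exact mul_le_mul_of_nonneg_left (FDMethod.tsum_weight_tail_le hr.le hr1 m) hC.delta_pos.le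
    · have hr1 : h / R = 1 := by rw [heq, div_self hR.ne']
      refine (main hr1.le x hx).trans_eq ?_
      congr 1
      refine tsum_congr fun j => ?_
      rw [h2, Real.rpow_natCast, hr1, FDMethod.weight, one_pow, add_comm j]
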